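/- Let $K$ be an arbitrary commutative ring and let $n,m$ be natural numbers. Let $S_n$ act on the polynomial ring $K[V^m]=K[x(i)_j \mid 1\le i\le m,\ 1\le j\le n]$ by simultaneously permuting the second indices. Let $\mathcal M$ be the set of non-empty (i.e. $\neq 1$) commutative monomials in symbols $x(1),\dots,x(m)$. For $w=x(1)^{a_1}\cdots x(m)^{a_m}\in\mathcal M$ put $w_{\langle j\rangle}=x(1)_j^{a_1}\cdots x(m)_j^{a_m}$ and $$\sigma_r(w)=\sum_{1\le i_1<\dots<i_r\le n} w_{\langle i_1\rangle}\cdots w_{\langle i_r\rangle}\in K[V^m]^{S_n}.$$ Let $\phi:K[e_r(w)\mid w\in\mathcal M,\ r=1,\dots,n]\to K[V^m]^{S_n}$ be the homomorphism of $K$-algebras from the polynomial ring in the indeterminates $e_r(w)$ with $\phi(e_r(w))=\sigma_r(w)$; put $e_r(w)=0$ for $r>n$. *The elements $S^\alpha$.* A non-empty word in non-commuting letters $Y_1,\dots,Y_s$ is reduced if it is not of the form $U_0^k$ with $k\ge 2$; words $U_1U_2$ and $U_2U_1$ are cyclically equivalent. For a multiset $P=\{(r_1,u_1),\dots,(r_d,u_d)\}$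 of pairs consisting of a positive integer $r_i$ and a non-empty commutative monomial $u_i$ in $y_1,\dots,y_s$, let $C_P$ be the number of multisets consisting of distinct cyclic equivalence classes $U_1,\dots,U_d$ of reduced words with multiplicities $r_1,\dots,r_d$ such that $Y_i\mapsto y_i$ sends $U_j$ to $u_j$ for all $j$ (equivalently, whose multiset of pairs (multiplicity, image of the class) is $P$). For $\alpha=(\alpha_1,\dots,\alpha_s)\in\mathbb N^s$, $l=\alpha_1+\dots+\alpha_s$ and $w_1,\dots,w_s\in\mathcal M$ let $$S^\alpha(w_1,\dots,w_s)=\sum_{P}(-1)^{l+r_1+\dots+r_d}\,C_P\; e_{r_1}(u_1(w_1,\dots,w_s))\cdots e_{r_d}(u_d(w_1,\dots,w_s)),$$ where $P=\{(r_1,u_1),\dots,(r_d,u_d)\}$ runs over all such multisets for which $u_1^{r_1}\cdots u_d^{r_d}=y_1^{\alpha_1}\cdots y_s^{\alpha_s}$. *The elements $Q_{r,k}$.* For $r\in\{1,\dots,n\}$ and $k\ge 2$ let $f_{r,k}\in\mathbb Z[t_1,\dots,t_n]$ be the unique polynomial such that $\sum_{i_1<\dots<i_r}x_{i_1}^k\cdots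 x_{i_r}^k=f_{r,k}(\sigma_1,\dots,\sigma_n)$, where $\sigma_i$ denotes the $i$th elementary symmetric polynomial in $x_1,\dots,x_n$, and for $w\in\mathcal M$ put $$Q_{r,k}(w)=e_r(w^k)-f_{r,k}(e_1(w),\dots,e_n(w)).$$ **Theorem.** The ideal $\ker(\phi)$ is generated by all the elements * $S^\alpha(w_1,\dots,w_s)$ with $s\ge 2$, $w_1,\dots,w_s\in\mathcal M$, $\alpha\in\mathbb N^s$, $\sum_{i=1}^s\alpha_i>n$ and $\sum_{i\ne j}\alpha_i\le n$ for all $j=1,\dots,s$, and * $Q_{r,k}(w)$ with $w\in\mathcal M$, $r\in\{1,\dots,n\}$, $k\ge 2$ and $k<1+n/r$. -/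

import Mathlib

namespace Multisymmetric

/-! Exponent vectors `w : Fin m →₀ ℕ` represent monomials `x(1)^{w 1} ⋯ x(m)^{w m}`, written
additively: `w + w'` is the product and `k • w` the `k`-th power of monomials. The non-empty
monomials are those with `w ≠ 0`. The coordinate ring `K[V^m]` is
`MvPolynomial (Fin m × Fin n) K`, the variable `X (i, j)` being `x(i)_j`. -/

/-- The monomial `w_⟨j⟩ = x(1)_j^{w 1} ⋯ x(m)_j^{w m}`. -/
noncomputable def place (K : Type*) [CommRing K] {n m : ℕ} (w : Fin m →₀ ℕ) (j : Fin n) :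
    MvPolynomial (Fin m × Fin n) K :=
  ∏ i : Fin m, MvPolynomial.X (i, j) ^ w i

/-- `σ_l(w) = ∑_{i_1 < ⋯ < i_l} w_⟨i_1⟩ ⋯ w_⟨i_l⟩`, the `l`-th characteristic coefficient of the
generic diagonal matrix `w`. -/
noncomputable def sigma (K : Type*) [CommRing K] (n : ℕ) {m : ℕ} (l : ℕ) (w : Fin m →₀ ℕ) :
    MvPolynomial (Fin m × Fin n) K :=
  ∑ I ∈ (Finset.univ : Finset (Fin n)).powersetCard l, ∏ j ∈ I, place K w j

/-- The algebra `K[V^m]^{S_n}` of multisymmetric polynomials: those fixed by all simultaneous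
permutations `x(i)_j ↦ x(i)_{τ j}`. -/
def multisymmetric (K : Type*) [CommRing K] (n m : ℕ) :
    Subalgebra K (MvPolynomial (Fin m × Fin n) K) where
  carrier := {p | ∀ τ : Equiv.Perm (Fin n),
    MvPolynomial.rename (fun q : Fin m × Fin n => (q.1, τ q.2)) p = p}
  mul_mem' := by
    intro a b ha hb τ
    rw [map_mul, ha τ, hb τ]
  add_mem' := by
    intro a b ha hb τ
    rw [map_add, ha τ, hb τ]
  algebraMap_mem' := by
    intro r τ
    exact AlgHom.commutes _ r

theorem sigma_mem (K : Type*) [CommRing K] (n m : ℕ) (l : ℕ) (w : Fin m →₀ ℕ) :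
    sigma K n l w ∈ multisymmetric K n m := by
  intro τ
  have hp : ∀ j : Fin n, MvPolynomial.rename (fun q : Fin m × Fin n => (q.1, τ q.2))
      (place K w j) = place K w (τ j) := by
    intro j
    simp [place, map_prod]
  simp only [sigma, map_sum, map_prod, hp]
  refine Finset.sum_bij (fun I _ => I.map τ.toEmbedding) ?_ ?_ ?_ ?_
  · intro I hI
    simpa [Finset.mem_powersetCard] using hI
  · intro I _ J _ h
    exact Finset.map_injective _ h
  · intro J hJ
    refine ⟨J.map τ.symm.toEmbedding, by simpa [Finset.mem_powersetCard] using hJ, ?_⟩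
    ext x
    simp
  · intro I _
    simp

/-- The index set of the indeterminates `e_r(w)`: pairs `(r, w)` with `1 ≤ r ≤ n` and `w` a
non-empty monomial. -/
abbrev EVar (n m : ℕ) : Type :=
  {p : ℕ × (Fin m →₀ ℕ) // (1 ≤ p.1 ∧ p.1 ≤ n) ∧ p.2 ≠ 0}

/-- The polynomial ring `K[e_r(w) | w a non-empty monomial, r = 1, …, n]`. -/
abbrev ERing (K : Type*) [CommRing K] (n m : ℕ) : Type _ := MvPolynomial (EVar n m) K

open Classical in
/-- The indeterminate `e_r(w)`; by convention it is `0` for `r > n`. (It is also set to `0` for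
`r = 0` and for `w = 0`; these values are never used below.) -/
noncomputable def e (K : Type*) [CommRing K] (n : ℕ) {m : ℕ} (r : ℕ) (w : Fin m →₀ ℕ) :
    ERing K n m :=
  if h : (1 ≤ r ∧ r ≤ n) ∧ w ≠ 0 then MvPolynomial.X ⟨(r, w), h⟩ else 0

/-- The `K`-algebra map `φ : K[e_r(w)] → K[V^m]^{S_n}` with `e_r(w) ↦ σ_r(w)`. -/
noncomputable def phi (K : Type*) [CommRing K] (n m : ℕ) :
    ERing K n m →ₐ[K] multisymmetric K n m :=
  MvPolynomial.aeval fun v => ⟨sigma K n v.1.1 v.1.2, sigma_mem K n m v.1.1 v.1.2⟩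

/-- A non-empty word in `Y_1, …, Y_s` is reduced if it is not a power `V^k` with `k ≥ 2`. -/
def IsReducedWord {s : ℕ} (U : List (Fin s)) : Prop :=
  U ≠ [] ∧ ∀ (V : List (Fin s)) (k : ℕ), 2 ≤ k → U ≠ (List.replicate k V).flatten

/-- The set of cyclic equivalence classes of reduced words in `Y_1, …, Y_s`. -/
def ReducedClass (s : ℕ) : Type :=
  {c : Cycle (Fin s) // ∃ U : List (Fin s), IsReducedWord U ∧ (U : Cycle (Fin s)) = c}

/-- The commuting monomial to which a cyclic class of words specializes under `Y_i ↦ x(i)`. -/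
noncomputable def ReducedClass.spec {s : ℕ} (U : ReducedClass s) : Fin s →₀ ℕ :=
  Multiset.toFinsupp U.1.toMultiset

/-- For a multiset `P` of pairs `(r_i, u_i)`, the number `C_P` of multisets
`{U_1, …, U_d; r_1, …, r_d}` of classes of reduced words (encoded by their multiplicity
functions `f`) which specialize to `P`. -/
noncomputable def amitsurC {s : ℕ} (P : Multiset (ℕ × (Fin s →₀ ℕ))) : ℕ :=
  Nat.card {f : ReducedClass s →₀ ℕ // f.support.val.map (fun U => (f U, U.spec)) = P}

/-- The set counted by `amitsurC` is finite. -/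
theorem amitsurC_finite {s : ℕ} (P : Multiset (ℕ × (Fin s →₀ ℕ))) :
    Finite {f : ReducedClass s →₀ ℕ // f.support.val.map (fun U => (f U, U.spec)) = P} := by
  classical
  have hfin : {U : ReducedClass s | U.spec ∈ (P.map Prod.snd).toFinset}.Finite := by
    have hA : ∀ u : Fin s →₀ ℕ, {U : ReducedClass s | U.spec = u}.Finite := by
      intro u
      have hL : {l : List (Fin s) | (l : Multiset (Fin s)) = Finsupp.toMultiset u}.Finite := by
        refine (List.finite_toSet (Finsupp.toMultiset u).toList.permutations).subset ?_
        intro l hl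
        simp only [Set.mem_ofPred_eq, List.mem_permutations] at hl ⊢
        rw [← Multiset.coe_eq_coe, hl, Multiset.coe_toList]
      refine Set.Finite.of_finite_image (f := Subtype.val) ?_ Subtype.val_injective.injOn
      refine (Set.Finite.image (fun l : List (Fin s) => (l : Cycle (Fin s))) hL).subset ?_
      rintro _ ⟨⟨c, U, hU, rfl⟩, hc, rfl⟩
      refine ⟨U, ?_, rfl⟩
      have hc' : Multiset.toFinsupp (U : Multiset (Fin s)) = u := hc
      simp [← hc']
    have : {U : ReducedClass s | U.spec ∈ (P.map Prod.snd).toFinset} =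
        ⋃ u ∈ (P.map Prod.snd).toFinset, {U : ReducedClass s | U.spec = u} := by
      ext U
      simp
    rw [this]
    exact Set.Finite.biUnion (Finset.finite_toSet _) fun u _ => hA u
  let g : ReducedClass s →₀ ℕ :=
    Finsupp.onFinset hfin.toFinset
      (fun U => if U ∈ hfin.toFinset then (P.map Prod.fst).sum else 0) (by
        intro U hU
        by_contra h
        exact hU (if_neg h))
  refine Set.Finite.to_subtype ((Set.finite_Iic g).subset ?_)
  rintro f rfl U
  by_cases hU : f U = 0
  · rw [hU]
    exact Nat.zero_le _
  · have hmem : (f U, U.spec) ∈ f.support.val.map (fun U => (f U, U.spec)) :=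
      Multiset.mem_map_of_mem (fun U : ReducedClass s => (f U, U.spec))
        (by simpa using hU : U ∈ f.support.val)
    have h1 : U ∈ hfin.toFinset := by
      simp only [Set.Finite.mem_toFinset, Set.mem_ofPred_eq, Multiset.mem_toFinset]
      exact Multiset.mem_map_of_mem Prod.snd hmem
    simp only [g, Finsupp.onFinset_apply, if_pos h1]
    exact Multiset.single_le_sum (fun _ _ => Nat.zero_le _) _
      (Multiset.mem_map_of_mem Prod.fst hmem)

/-- The multisets `{(r_1, u_1), …, (r_d, u_d)}` of pairs with `r_i` positive, `u_i` a non-empty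
monomial in `x(1), …, x(s)`, and `u_1^{r_1} ⋯ u_d^{r_d}` of multidegree `α`. -/
def amitsurIndex {s : ℕ} (α : Fin s →₀ ℕ) : Set (Multiset (ℕ × (Fin s →₀ ℕ))) :=
  {P | (∀ p ∈ P, p.1 ≠ 0 ∧ p.2 ≠ 0) ∧ (P.map fun p => p.1 • p.2).sum = α}

theorem amitsurIndex_finite {s : ℕ} (α : Fin s →₀ ℕ) : (amitsurIndex α).Finite := by
  classical
  set N : ℕ := α.degree with hN
  let B : Finset (ℕ × (Fin s →₀ ℕ)) := Finset.range (N + 1) ×ˢ Finset.Iic α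
  refine (Finset.finite_toSet ((N • B.val).powerset.toFinset)).subset ?_
  rintro P ⟨hP, hs⟩
  have hdeg : (P.map fun p => p.1 * p.2.degree).sum = N := by
    rw [hN, ← hs, map_multiset_sum, Multiset.map_map]
    simp
  have hd : ∀ p ∈ P, 1 ≤ p.2.degree := fun p hp =>
    Nat.one_le_iff_ne_zero.2 (fun h => (hP p hp).2 ((Finsupp.degree_eq_zero_iff _).1 h))
  have hcard : P.card ≤ N := by
    rw [← hdeg]
    have := Multiset.card_nsmul_le_sum (s := P.map fun p => p.1 * p.2.degree) (a := 1) (by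
      intro x hx
      obtain ⟨p, hp, rfl⟩ := Multiset.mem_map.1 hx
      exact Nat.mul_pos (Nat.pos_of_ne_zero (hP p hp).1) (hd p hp))
    simpa using this
  have hB : ∀ p ∈ P, p ∈ B := by
    intro p hp
    have h1 : p.1 * p.2.degree ≤ N := by
      rw [← hdeg]
      exact Multiset.single_le_sum (fun _ _ => Nat.zero_le _) _ (Multiset.mem_map_of_mem _ hp)
    have h2 : p.1 • p.2 ≤ α := by
      rw [← hs]
      exact Multiset.single_le_sum (fun x _ => bot_le) _
        (Multiset.mem_map_of_mem (fun p : ℕ × (Fin s →₀ ℕ) => p.1 • p.2) hp)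
    have h3 : p.2 ≤ p.1 • p.2 := by
      intro i
      simpa using Nat.le_mul_of_pos_left (p.2 i) (Nat.pos_of_ne_zero (hP p hp).1)
    simp only [B, Finset.mem_product, Finset.mem_range, Finset.mem_Iic]
    refine ⟨?_, h3.trans h2⟩
    have := Nat.le_mul_of_pos_right p.1 (hd p hp)
    omega
  simp only [Finset.mem_coe, Multiset.mem_toFinset, Multiset.mem_powerset]
  rw [Multiset.le_iff_count]
  intro p
  by_cases hp : p ∈ P
  · have : Multiset.count p B.val = 1 := Multiset.count_eq_one_of_mem B.nodup (hB p hp)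
    rw [Multiset.count_nsmul, this, mul_one]
    exact (Multiset.count_le_card p P).trans hcard
  · simp [Multiset.count_eq_zero_of_notMem hp]

/-- The monomial obtained from `u = x(1)^{u 1} ⋯ x(s)^{u s}` by `x(i) ↦ w_i`. -/
noncomputable def subst {s m : ℕ} (w : Fin s → (Fin m →₀ ℕ)) (u : Fin s →₀ ℕ) : Fin m →₀ ℕ :=
  ∑ i : Fin s, u i • w i

/-- `S^α(w_1, …, w_s) = ∑ (-1)^{l + r_1 + ⋯ + r_d} C_{{(r_1,u_1),…,(r_d,u_d)}}
e_{r_1}(u_1(w)) ⋯ e_{r_d}(u_d(w))`, where `l = α_1 + ⋯ + α_s`: the right hand side of Amitsur's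
formula after the substitution `x(i) ↦ w_i`. -/
noncomputable def amitsurS (K : Type*) [CommRing K] (n : ℕ) {m s : ℕ} (α : Fin s →₀ ℕ)
    (w : Fin s → (Fin m →₀ ℕ)) : ERing K n m :=
  ∑ P ∈ (amitsurIndex_finite α).toFinset,
    (-1) ^ ((∑ i, α i) + (P.map Prod.fst).sum) * (amitsurC P : ERing K n m) *
      (P.map fun p => e K n p.1 (subst w p.2)).prod

/-- `σ_j(x^k)` in the case of a single diagonal matrix `x = diag(x_1, …, x_n)` over `ℤ`. -/
noncomputable def sigmaPow (n j k : ℕ) : MvPolynomial (Fin n) ℤ :=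
  ∑ I ∈ (Finset.univ : Finset (Fin n)).powersetCard j, ∏ i ∈ I, MvPolynomial.X i ^ k

theorem sigmaPow_isSymmetric (n j k : ℕ) : (sigmaPow n j k).IsSymmetric := by
  intro τ
  simp only [sigmaPow, map_sum, map_prod, map_pow, MvPolynomial.rename_X]
  refine Finset.sum_bij (fun I _ => I.map τ.toEmbedding) ?_ ?_ ?_ ?_
  · intro I hI
    simpa [Finset.mem_powersetCard] using hI
  · intro I _ J _ h
    exact Finset.map_injective _ h
  · intro J hJ
    refine ⟨J.map τ.symm.toEmbedding, by simpa [Finset.mem_powersetCard] using hJ, ?_⟩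
    ext x
    simp
  · intro I _
    simp

/-- There is exactly one `f ∈ ℤ[t_1, …, t_n]` with `σ_j(x^k) = f(σ_1(x), …, σ_n(x))`; the
variable `t_i` is `X (i - 1)`. -/
theorem existsUnique_sigmaPow (n j k : ℕ) : ∃! f : MvPolynomial (Fin n) ℤ,
    MvPolynomial.aeval (fun i : Fin n => sigmaPow n (i + 1) 1) f = sigmaPow n j k := by
  have h : (fun i : Fin n => sigmaPow n (i + 1) 1) =
      fun i : Fin n => MvPolynomial.esymm (Fin n) ℤ (i + 1) := by
    funext i
    simp [sigmaPow, MvPolynomial.esymm]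
  rw [h]
  have hb := MvPolynomial.esymmAlgHom_fin_bijective ℤ n
  obtain ⟨f, hf⟩ := hb.2 ⟨sigmaPow n j k, sigmaPow_isSymmetric n j k⟩
  refine ⟨f, ?_, ?_⟩
  · have := congrArg Subtype.val hf
    rwa [MvPolynomial.esymmAlgHom_apply] at this
  · intro g hg
    apply hb.1
    rw [hf]
    apply Subtype.ext
    rw [MvPolynomial.esymmAlgHom_apply]
    exact hg

/-- The polynomial `f_{j,k}` with integer coefficients such that
`σ_j(x^k) = f_{j,k}(σ_1(x), …, σ_n(x))`. -/
noncomputable def fpoly (n j k : ℕ) : MvPolynomial (Fin n) ℤ :=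
  (existsUnique_sigmaPow n j k).choose

/-- `Q_{j,k}(w) = e_j(w^k) - f_{j,k}(e_1(w), …, e_n(w))`. -/
noncomputable def Q (K : Type*) [CommRing K] (n : ℕ) {m : ℕ} (j k : ℕ) (w : Fin m →₀ ℕ) :
    ERing K n m :=
  e K n j (k • w) - MvPolynomial.aeval (fun i : Fin n => e K n (i + 1) w) (fpoly n j k)

end Multisymmetric

/-!
Modulo the ideal `J` generated by the listed elements, every polynomial in the `e_r(w)` is a linear
combination of the products `E_f = ∏_u e_{f(u)}(u)`, where `f` runs over the multisets of at most
`n` monomials `u ≠ 1` (`stdSpan_eq_top`). The images `φ(E_f)` are linearly independent over `K`: the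
number of places carrying a non-trivial monomial makes them unitriangular with respect to orbit
sums (`coeff_phi_stdProd`, `eq_zero_of_phi_linearCombination`). As `J ≤ ker φ`, the two facts give
`ker φ = J`.

That `φ` kills `S^α(w)` for `|α| > n` is Amitsur's formula (`coe_phi_amitsurS`): `φ(S^α(w))` is the
coefficient of `t^α` in `σ_l(∑ t_i w_i)`, `l = |α|`. For diagonal matrices it reduces, place by
place, to the cyclotomic identity `∏_U (1 - a^U) = 1 - ∑ a_i`, with `U` running over the cyclic
classes of reduced words (`coeff_eulerProd`). The latter is proved by comparing logarithmic
derivatives: every non-empty word is in exactly one way a power of a reduced word, and a class of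
reduced words of length `l` has `l` members (`pow_sum_eq_sum_classes`).

For the spanning statement give `e_r(w)` the weight `r`. The leading term of `S^α(w)` is
`∏ e_{α_i}(w_i)`, all others having smaller weight (`degree_lt_of_ne_letters`). A product of weight
greater than `n` contains a minimal such subproduct, which is the leading term of an `S^α(w)` in `J`
(`exists_leading_le`), so its weight can be lowered. A product with a repeated monomial is
treated by means of `S^{(r,r')}(u, u)`, which is congruent modulo `J` to a multiple of
`e_{r+r'}(u)` (`exists_amitsurS_const_sub_mem`). The last congruence holds because modulo `J` every
`e_r(u^k)` is a polynomial in `e_1(u), …, e_n(u)` (`e_nsmul_mem_polyIn`), and the `σ_i(u)` are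
algebraically independent. Here the relations `Q_{r,k}(u)` are needed only for `k < 1 + n / r`; for
larger `k` the power `e_r(u^k)` is eliminated by `S^{(r i, r)}(u, u^{k-i})` with `i = ⌊n / r⌋`.
-/

namespace Multisymmetric

/-! ### Primitive roots of words -/

section Words

variable {β : Type*}

/-- The power `V^k` of a word, that is, `k` copies of `V` in a row. -/
def wordPow (V : List β) (k : ℕ) : List β := (List.replicate k V).flatten

theorem wordPow_zero (V : List β) : wordPow V 0 = [] := rfl

theorem wordPow_one (V : List β) : wordPow V 1 = V := by simp [wordPow]

theorem wordPow_succ (V : List β) (k : ℕ) : wordPow V (k + 1) = V ++ wordPow V k := by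
  simp [wordPow, List.replicate_succ]

theorem wordPow_add (V : List β) (j k : ℕ) :
    wordPow V (j + k) = wordPow V j ++ wordPow V k := by
  rw [wordPow, List.replicate_add, List.flatten_append, wordPow, wordPow]

theorem length_wordPow (V : List β) (k : ℕ) : (wordPow V k).length = k * V.length := by
  simp [wordPow]

theorem wordPow_wordPow (V : List β) (j k : ℕ) : wordPow (wordPow V j) k = wordPow V (j * k) := by
  induction k with
  | zero => rfl
  | succ k ih => rw [wordPow_succ, ih, Nat.mul_succ, add_comm, wordPow_add]

theorem count_wordPow [DecidableEq β] (V : List β) (k : ℕ) (b : β) :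
    (wordPow V k).count b = k * V.count b := by
  induction k with
  | zero => simp [wordPow_zero]
  | succ k ih => rw [wordPow_succ, List.count_append, ih]; ring

theorem wordPow_rotate (V : List β) (k : ℕ) : (wordPow V k).rotate V.length = wordPow V k := by
  cases k with
  | zero => simp [wordPow_zero]
  | succ k =>
    rw [wordPow_succ, List.rotate_append_length_eq]
    calc wordPow V k ++ V = wordPow V k ++ wordPow V 1 := by rw [wordPow_one]
      _ = V ++ wordPow V k := by rw [← wordPow_add, wordPow_succ]

/-- A word commuting with `a` whose length is a multiple of that of `a` is a power of `a`. -/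
theorem eq_wordPow_of_append_comm (a : List β) (k : ℕ) :
    ∀ b : List β, b.length = k * a.length → a ++ b = b ++ a → b = wordPow a k := by
  induction k with
  | zero => intro b hb _; simpa [wordPow_zero] using hb
  | succ k ih =>
    intro b hb h
    obtain ⟨c, rfl⟩ : ∃ c, b = a ++ c := by
      have h1 : a <+: b ++ a := ⟨b, h⟩
      have h2 : b <+: b ++ a := ⟨a, rfl⟩
      obtain ⟨c, hc⟩ := List.prefix_of_prefix_length_le h1 h2 (by rw [hb]; nlinarith)
      exact ⟨c, hc.symm⟩
    rw [wordPow_succ, ← ih c]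
    · simp only [List.length_append] at hb
      nlinarith
    · simpa using h

theorem rotate_iterate (l : List β) (k : ℕ) : (fun l : List β => l.rotate 1)^[k] l = l.rotate k := by
  induction k with
  | zero => simp
  | succ k ih => rw [Function.iterate_succ_apply', ih, List.rotate_rotate]

theorem rotate_gcd {W : List β} {i j : ℕ} (hi : W.rotate i = W) (hj : W.rotate j = W) :
    W.rotate (i.gcd j) = W := by
  have hi' : Function.IsPeriodicPt (fun l : List β => l.rotate 1) i W := by
    rw [Function.IsPeriodicPt, Function.IsFixedPt, rotate_iterate, hi]
  have hj' : Function.IsPeriodicPt (fun l : List β => l.rotate 1) j W := by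
    rw [Function.IsPeriodicPt, Function.IsFixedPt, rotate_iterate, hj]
  have h := hi'.gcd hj'
  rwa [Function.IsPeriodicPt, Function.IsFixedPt, rotate_iterate] at h

theorem eq_wordPow_of_rotate {W : List β} {g : ℕ} (hg : g ∣ W.length) (h : W.rotate g = W) :
    W = wordPow (W.take g) (W.length / g) := by
  rcases eq_or_ne W [] with rfl | hW
  · simp [wordPow]
  have hpos : 0 < W.length := List.length_pos_iff.2 hW
  have hle : g ≤ W.length := Nat.le_of_dvd hpos hg
  have hlen : (W.take g).length = g := by simp [hle]
  apply eq_wordPow_of_append_comm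
  · rw [hlen, Nat.div_mul_cancel hg]
  · have h1 : W.drop g ++ W.take g = W := by rw [← List.rotate_eq_drop_append_take hle, h]
    calc W.take g ++ W = W.take g ++ (W.drop g ++ W.take g) := by rw [h1]
      _ = W ++ W.take g := by rw [← List.append_assoc, List.take_append_drop]

end Words

section Reduced

variable {s : ℕ}

theorem isReducedWord_iff {U : List (Fin s)} :
    IsReducedWord U ↔ U ≠ [] ∧ ∀ (V : List (Fin s)) (k : ℕ), 2 ≤ k → U ≠ wordPow V k := Iff.rfl

/-- A reduced word is fixed only by the rotations through multiples of its length. -/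
theorem IsReducedWord.dvd_of_rotate {V : List (Fin s)} (hV : IsReducedWord V) {d : ℕ}
    (h : V.rotate d = V) : V.length ∣ d := by
  have hpos : 0 < V.length := List.length_pos_iff.2 hV.1
  have hg := rotate_gcd h (List.rotate_length V)
  have hdvd : d.gcd V.length ∣ V.length := Nat.gcd_dvd_right _ _
  have hE := eq_wordPow_of_rotate hdvd hg
  obtain ⟨q, hq⟩ := hdvd
  have hgpos : 0 < d.gcd V.length := Nat.gcd_pos_of_pos_right _ hpos
  have hq2 : ¬ 2 ≤ V.length / d.gcd V.length := fun h2 => hV.2 _ _ h2 hE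
  have hdiv : V.length / d.gcd V.length = q := Nat.div_eq_of_eq_mul_right hgpos hq
  rw [hdiv] at hq2
  have hq1 : q = 1 := by
    rcases q with _ | _ | q
    · omega
    · rfl
    · omega
  rw [hq1, mul_one] at hq
  rw [hq]
  exact Nat.gcd_dvd_left _ _

/-- Every non-empty word is a power of a reduced word. -/
theorem exists_reduced_root (W : List (Fin s)) (hW : W ≠ []) :
    ∃ V k, IsReducedWord V ∧ 1 ≤ k ∧ W = wordPow V k := by
  by_cases hr : IsReducedWord W
  · exact ⟨W, 1, hr, le_rfl, (wordPow_one W).symm⟩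
  · rw [isReducedWord_iff] at hr
    push Not at hr
    obtain ⟨V, k, hk, hE⟩ := hr hW
    have hV : V ≠ [] := by
      rintro rfl
      apply hW
      rw [hE, ← List.length_eq_zero_iff, length_wordPow]
      simp
    have hlt : V.length < W.length := by
      have := List.length_pos_iff.2 hV
      rw [hE, length_wordPow]
      nlinarith
    obtain ⟨V', j, hV', hj, rfl⟩ := exists_reduced_root V hV
    exact ⟨V', j * k, hV', by nlinarith, by rw [hE, wordPow_wordPow]⟩
termination_by W.length

/-- The reduced root of a non-empty word is unique. -/
theorem reduced_root_unique {V V' : List (Fin s)} (hV : IsReducedWord V) (hV' : IsReducedWord V')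
    {k k' : ℕ} (hk : 1 ≤ k) (hk' : 1 ≤ k') (h : wordPow V k = wordPow V' k') : V = V' := by
  -- both roots are periods of the common power, hence so is the gcd of their lengths
  have hl : ∀ {U U' : List (Fin s)}, IsReducedWord U → IsReducedWord U' → ∀ {j j' : ℕ}, 1 ≤ j →
      wordPow U j = wordPow U' j' → U.length ∣ U'.length := by
    intro U U' hU hU' j j' hj hE
    obtain ⟨j, rfl⟩ : ∃ i, j = i + 1 := ⟨j - 1, by omega⟩
    set W := wordPow U (j + 1) with hW
    have h1 : W.rotate U.length = W := wordPow_rotate _ _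
    have h2 : W.rotate U'.length = W := by rw [hE]; exact wordPow_rotate _ _
    have hg := rotate_gcd h1 h2
    set g := U.length.gcd U'.length with hgdef
    have hgU : g ∣ U.length := Nat.gcd_dvd_left _ _
    have hgW : g ∣ W.length := by rw [hW, length_wordPow]; exact hgU.mul_left _
    have hEW := eq_wordPow_of_rotate hgW hg
    have hUpos : 0 < U.length := List.length_pos_iff.2 hU.1
    have hgpos : 0 < g := Nat.gcd_pos_of_pos_left _ hUpos
    obtain ⟨q, hq⟩ := hgU
    -- `W` is a power of its prefix of length `g`, hence so is its prefix `U`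
    have hgle : g ≤ W.length := Nat.le_of_dvd
      (by rw [hW, length_wordPow]; exact Nat.mul_pos (Nat.succ_pos _) hUpos) hgW
    have hWdiv : W.length / g = q + q * j := by
      apply Nat.div_eq_of_eq_mul_right hgpos
      rw [hW, length_wordPow, hq]; ring
    rw [hWdiv, wordPow_add, hW, wordPow_succ] at hEW
    have hUE := (List.append_inj hEW (by
      rw [length_wordPow, ← wordPow_succ, ← hW, List.length_take, min_eq_left hgle, hq, mul_comm])).1
    have hq2 : ¬ 2 ≤ q := fun h2 => hU.2 _ _ h2 hUE
    have hq1 : q = 1 := by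
      rcases q with _ | _ | q
      · omega
      · rfl
      · omega
    rw [hq1, mul_one] at hq
    rw [hq]
    exact Nat.gcd_dvd_right _ _
  have hlen : V.length = V'.length :=
    Nat.dvd_antisymm (hl hV hV' hk h) (hl hV' hV hk' h.symm)
  obtain ⟨k, rfl⟩ : ∃ i, k = i + 1 := ⟨k - 1, by omega⟩
  obtain ⟨k', rfl⟩ : ∃ i, k' = i + 1 := ⟨k' - 1, by omega⟩
  rw [wordPow_succ, wordPow_succ] at h
  exact (List.append_inj h hlen).1

theorem IsReducedWord.rotate {V : List (Fin s)} (hV : IsReducedWord V) (i : ℕ) :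
    IsReducedWord (V.rotate i) := by
  refine ⟨fun h => hV.1 (List.rotate_eq_nil_iff.1 h), fun T k hk hE => ?_⟩
  change V.rotate i = wordPow T k at hE
  have h1 := wordPow_rotate T k
  rw [← hE, List.rotate_rotate, add_comm, ← List.rotate_rotate, List.rotate_eq_rotate] at h1
  have hd := hV.dvd_of_rotate h1
  have hlen : V.length = k * T.length := by
    rw [← length_wordPow, ← hE, List.length_rotate]
  have hpos : 0 < V.length := List.length_pos_iff.2 hV.1
  have hT : 0 < T.length := by
    rcases Nat.eq_zero_or_pos T.length with h0 | h0
    · rw [h0] at hlen; omega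
    · exact h0
  have := Nat.le_of_dvd hT hd
  nlinarith

theorem IsReducedWord.rotate_inj {V : List (Fin s)} (hV : IsReducedWord V) {i j : ℕ}
    (hi : i < V.length) (hj : j < V.length) (h : V.rotate i = V.rotate j) : i = j := by
  wlog hij : i ≤ j generalizing i j
  · exact (this hj hi h.symm (by omega)).symm
  have h2 : V.rotate (j - i) = V := by
    apply List.rotate_injective i
    simp only [List.rotate_rotate, Nat.sub_add_cancel hij, h]
  have := hV.dvd_of_rotate h2
  by_contra hne
  have := Nat.le_of_dvd (by omega) this
  omega

namespace ReducedClass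

/-- A reduced word representing the class `U`. -/
noncomputable def rep (U : ReducedClass s) : List (Fin s) := U.2.choose

theorem rep_reduced (U : ReducedClass s) : IsReducedWord U.rep := U.2.choose_spec.1

theorem coe_rep (U : ReducedClass s) : (U.rep : Cycle (Fin s)) = U.1 := U.2.choose_spec.2

/-- The class of a reduced word. -/
def mk (V : List (Fin s)) (hV : IsReducedWord V) : ReducedClass s := ⟨V, V, hV, rfl⟩

/-- The common length of the words in the class `U`. -/
noncomputable def len (U : ReducedClass s) : ℕ := U.rep.length

theorem len_pos (U : ReducedClass s) : 0 < U.len := List.length_pos_iff.2 U.rep_reduced.1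

theorem spec_mk (V : List (Fin s)) (hV : IsReducedWord V) (i : Fin s) :
    (mk V hV).spec i = V.count i := by
  classical
  simp [spec, mk]

theorem spec_apply (U : ReducedClass s) (i : Fin s) : U.spec i = U.rep.count i := by
  classical
  rw [spec, ← U.coe_rep]
  simp

theorem mk_rep (U : ReducedClass s) : mk U.rep U.rep_reduced = U := Subtype.ext U.coe_rep

theorem mk_eq_iff {V V' : List (Fin s)} {hV : IsReducedWord V} {hV' : IsReducedWord V'} :
    mk V hV = mk V' hV' ↔ V ~r V' := by
  rw [← Cycle.coe_eq_coe]
  exact Subtype.ext_iff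

theorem sum_spec (U : ReducedClass s) : ∑ i, U.spec i = U.len := by
  classical
  simp only [spec_apply, len]
  simpa using Multiset.sum_count_eq_card (s := Finset.univ) (m := (U.rep : Multiset (Fin s)))
    (by simp)

theorem degree_spec (U : ReducedClass s) : U.spec.degree = U.len := by
  rw [Finsupp.degree_eq_sum, sum_spec]

theorem spec_ne_zero (U : ReducedClass s) : U.spec ≠ 0 := by
  intro h
  have h1 := U.degree_spec
  rw [h] at h1
  have := U.len_pos
  simp at h1
  omega

theorem finite_len_le (L : ℕ) : {U : ReducedClass s | U.len ≤ L}.Finite := by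
  refine Set.Finite.of_finite_image (f := rep) ?_ ?_
  · refine (List.finite_length_le (Fin s) L).subset ?_
    rintro _ ⟨U, hU, rfl⟩
    exact hU
  · intro U _ U' _ h
    apply Subtype.ext
    rw [← U.coe_rep, ← U'.coe_rep, h]

/-- The finite set of classes of words of length at most `L`. -/
noncomputable def upTo (s L : ℕ) : Finset (ReducedClass s) := (finite_len_le L).toFinset

@[simp] theorem mem_upTo {L : ℕ} {U : ReducedClass s} : U ∈ upTo s L ↔ U.len ≤ L := by
  simp [upTo]

end ReducedClass

end Reduced

section WordSum

variable {s : ℕ} {A : Type*} [CommRing A]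

/-- The value at `a` of the monomial with exponent vector `u`. -/
def mono (a : Fin s → A) (u : Fin s →₀ ℕ) : A := ∏ i, a i ^ u i

theorem prod_map_eq_prod_count (a : Fin s → A) (W : List (Fin s)) :
    (W.map a).prod = ∏ i, a i ^ W.count i := by
  classical
  exact Finset.prod_list_map_count W a |>.trans (Finset.prod_subset (Finset.subset_univ _) (by
    intro i _ hi
    rw [List.count_eq_zero_of_not_mem (by simpa using hi), pow_zero]))

/-- Sorting all words of length `n` by the class of their reduced root. -/
theorem pow_sum_eq_sum_classes (a : Fin s → A) {n L : ℕ} (hn : 1 ≤ n) (hL : n ≤ L) :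
    (∑ i, a i) ^ n = ∑ U ∈ ReducedClass.upTo s L with U.len ∣ n,
      (U.len : A) * mono a U.spec ^ (n / U.len) := by
  classical
  have hpow : (∑ i, a i) ^ n = ∑ g : Fin n → Fin s, ((List.ofFn g).map a).prod := by
    rw [Fintype.sum_pow]
    refine Finset.sum_congr rfl fun g _ => ?_
    rw [List.map_ofFn, List.prod_ofFn]
    rfl
  have hsig : ∑ U ∈ ReducedClass.upTo s L with U.len ∣ n,
      (U.len : A) * mono a U.spec ^ (n / U.len) =
      ∑ p ∈ ((ReducedClass.upTo s L).filter fun U => U.len ∣ n).sigma fun U => Finset.range U.len,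
        ((wordPow (p.1.rep.rotate p.2) (n / p.1.len)).map a).prod := by
    rw [Finset.sum_sigma]
    refine Finset.sum_congr rfl fun U _ => ?_
    rw [Finset.sum_congr rfl (g := fun _ => mono a U.spec ^ (n / U.len))]
    · simp
    · intro i _
      rw [prod_map_eq_prod_count, mono, ← Finset.prod_pow]
      refine Finset.prod_congr rfl fun j _ => ?_
      rw [count_wordPow, (List.rotate_perm U.rep i).count_eq, U.spec_apply, ← pow_mul, mul_comm]
  have hlen : ∀ (U : ReducedClass s) (i : ℕ), U.len ∣ n →
      (wordPow (U.rep.rotate i) (n / U.len)).length = n := by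
    intro U i hU
    rw [length_wordPow, List.length_rotate]
    exact Nat.div_mul_cancel hU
  rw [hpow, hsig]
  symm
  refine Finset.sum_bij
    (fun p hp => fun t : Fin n => (wordPow (p.1.rep.rotate p.2) (n / p.1.len)).get
      (t.cast (hlen p.1 p.2 (Finset.mem_filter.1 (Finset.mem_sigma.1 hp).1).2).symm)) ?_ ?_ ?_ ?_
  · intros; exact Finset.mem_univ _
  · rintro ⟨U, i⟩ hp ⟨U', i'⟩ hp' h
    simp only [Finset.mem_sigma, Finset.mem_filter, ReducedClass.mem_upTo, Finset.mem_range]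
      at hp hp'
    have hW : wordPow (U.rep.rotate i) (n / U.len) = wordPow (U'.rep.rotate i') (n / U'.len) := by
      refine List.ext_get (by rw [hlen _ _ hp.1.2, hlen _ _ hp'.1.2]) fun t h1 h2 => ?_
      have := congrFun h ⟨t, by rwa [hlen _ _ hp.1.2] at h1⟩
      simpa using this
    have hk : ∀ V : ReducedClass s, V.len ∣ n → 1 ≤ n / V.len := fun V hV =>
      Nat.div_pos (Nat.le_of_dvd hn hV) V.len_pos
    have hroot := reduced_root_unique (U.rep_reduced.rotate i) (U'.rep_reduced.rotate i')
      (hk U hp.1.2) (hk U' hp'.1.2) hW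
    have hUU : U = U' := by
      rw [← U.mk_rep, ← U'.mk_rep, ReducedClass.mk_eq_iff]
      have h1 : U.rep ~r U.rep.rotate i := ⟨i, rfl⟩
      have h2 : U'.rep ~r U'.rep.rotate i' := ⟨i', rfl⟩
      rw [hroot] at h1
      exact h1.trans h2.symm
    subst hUU
    have := U.rep_reduced.rotate_inj hp.2 hp'.2 hroot
    rw [this]
  · intro g _
    obtain ⟨V, k, hV, hk, hE⟩ := exists_reduced_root (List.ofFn g) (by
      intro h
      have := congrArg List.length h
      simp at this
      omega)
    have hlenV : n = k * V.length := by
      have := congrArg List.length hE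
      rwa [List.length_ofFn, length_wordPow] at this
    set U := ReducedClass.mk V hV with hU
    have hrot : U.rep ~r V := by
      have := U.mk_rep
      rw [hU, ReducedClass.mk_eq_iff] at this
      exact this
    have hUlen : U.len = V.length := hrot.perm.length_eq
    have hVpos : 0 < V.length := List.length_pos_iff.2 hV.1
    obtain ⟨i, hi⟩ := hrot
    have hi' : U.rep.rotate (i % U.len) = V := by rw [ReducedClass.len, List.rotate_mod, hi]
    have hdvd : U.len ∣ n := by rw [hUlen, hlenV]; exact dvd_mul_left _ _
    refine ⟨⟨U, i % U.len⟩, ?_, ?_⟩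
    · simp only [Finset.mem_sigma, Finset.mem_filter, ReducedClass.mem_upTo, Finset.mem_range]
      exact ⟨⟨(Nat.le_of_dvd hn hdvd).trans hL, hdvd⟩, Nat.mod_lt _ U.len_pos⟩
    · have hnk : n / U.len = k := by
        rw [hUlen]; exact Nat.div_eq_of_eq_mul_left hVpos hlenV
      have hW : wordPow (U.rep.rotate (i % U.len)) (n / U.len) = List.ofFn g := by
        rw [hi', hnk, hE]
      funext t
      simp [hW]
  · intro p hp
    have hd := (Finset.mem_filter.1 (Finset.mem_sigma.1 hp).1).2
    congr 2
    refine (List.ext_get (by rw [List.length_ofFn, hlen _ _ hd]) fun t h1 h2 => ?_).symm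
    simp

end WordSum

/-! ### The cyclotomic identity -/

section Cyclotomic

open PowerSeries

variable {s : ℕ} {A : Type*} [CommRing A]

/-- The truncated Euler product `∏_U (1 - a^U z^{|U|})` over the classes of reduced words of
length at most `L`. -/
noncomputable def eulerProd (a : Fin s → A) (L : ℕ) : PowerSeries A :=
  ∏ U ∈ ReducedClass.upTo s L, (1 - C (mono a U.spec) * X ^ U.len)

/-- The series `c z^l + c² z^{2l} + ⋯ = c z^l / (1 - c z^l)`. -/
noncomputable def geomTail (c : A) (l : ℕ) : PowerSeries A :=
  PowerSeries.mk fun k => if k ≠ 0 ∧ l ∣ k then c ^ (k / l) else 0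

theorem one_sub_mul_geomTail (c : A) {l : ℕ} (hl : 1 ≤ l) :
    (1 - C c * X ^ l) * geomTail c l = C c * X ^ l := by
  ext k
  rw [sub_mul, one_mul, mul_assoc, map_sub, coeff_C_mul, coeff_C_mul, coeff_X_pow_mul', coeff_X_pow,
    geomTail, coeff_mk]
  by_cases hlk : l ≤ k
  · obtain ⟨j, rfl⟩ := Nat.exists_eq_add_of_le hlk
    have h0 : l + j ≠ 0 := by omega
    by_cases hj : j = 0
    · subst hj
      simp [Nat.div_self (show 0 < l by omega), show l ≠ 0 by omega]
    · by_cases hd : l ∣ j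
      · have hd' : l ∣ l + j := (Nat.dvd_add_right (dvd_refl l)).2 hd
        have hdiv : (l + j) / l = j / l + 1 := by rw [Nat.add_div_left _ (by omega)]
        simp [hj, hd, hdiv, pow_succ, mul_comm]
      · have hd' : ¬ l ∣ l + j := fun h => hd ((Nat.dvd_add_right (dvd_refl l)).1 h)
        simp [hj, hd]
  · have h1 : ¬ (k ≠ 0 ∧ l ∣ k) := fun h => hlk (Nat.le_of_dvd (by omega) h.2)
    rw [if_neg h1, if_neg hlk, if_neg (by omega)]
    simp

/-- The logarithmic derivative of the Euler product. -/
theorem X_mul_derivative_prod {ι : Type*} (S : Finset ι) (c : ι → A) (l : ι → ℕ)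
    (hl : ∀ i, 1 ≤ l i) :
    X * d⁄dX A (∏ i ∈ S, (1 - C (c i) * X ^ l i)) =
      -((∏ i ∈ S, (1 - C (c i) * X ^ l i)) * ∑ i ∈ S, (l i : PowerSeries A) * geomTail (c i) (l i)) := by
  classical
  induction S using Finset.induction_on with
  | empty => simp
  | insert i S hi ih =>
    have hd : X * d⁄dX A (1 - C (c i) * X ^ l i) =
        -((l i : PowerSeries A) * (C (c i) * X ^ l i)) := by
      obtain ⟨k, hk⟩ : ∃ k, l i = k + 1 := ⟨l i - 1, by have := hl i; omega⟩
      rw [map_sub, Derivation.leibniz, derivative_C, derivative_pow, hk]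
      simp
      ring
    rw [Finset.prod_insert hi, Finset.sum_insert hi, Derivation.leibniz]
    set F := ∏ i ∈ S, (1 - C (c i) * X ^ l i)
    calc X * ((1 - C (c i) * X ^ l i) • d⁄dX A F + F • d⁄dX A (1 - C (c i) * X ^ l i))
        = (1 - C (c i) * X ^ l i) * (X * d⁄dX A F) +
            F * (X * d⁄dX A (1 - C (c i) * X ^ l i)) := by
          simp only [smul_eq_mul]; ring
      _ = _ := by
        rw [ih, hd]
        linear_combination (F * (l i : PowerSeries A)) * one_sub_mul_geomTail (c i) (hl i)

/-- Newton's recursion `k x_k = -∑_{j ≥ 1} x_{k-j} p^j` with `x_0 = 1` has the only solution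
`1, -p, 0, 0, …` in characteristic zero. -/
theorem eq_of_newton_recursion [IsDomain A] [CharZero A] (x : ℕ → A) (p : A) (L : ℕ) (h0 : x 0 = 1)
    (hx : ∀ k, 1 ≤ k → k ≤ L → (k : A) * x k = -∑ i ∈ Finset.range k, x i * p ^ (k - i)) :
    ∀ k ≤ L, x k = if k = 0 then 1 else if k = 1 then -p else 0 := by
  intro k
  induction k using Nat.strong_induction_on with
  | _ k ih =>
    intro hk
    rcases k with _ | _ | k
    · simpa using h0
    · have := hx 1 le_rfl hk
      simpa [h0] using this
    · have hr := hx (k + 2) (by omega) hk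
      rw [Finset.sum_range_succ', Finset.sum_range_succ'] at hr
      have hz : ∑ i ∈ Finset.range k, x (i + 1 + 1) * p ^ (k + 2 - (i + 1 + 1)) = 0 := by
        refine Finset.sum_eq_zero fun i hi => ?_
        rw [Finset.mem_range] at hi
        rw [ih (i + 1 + 1) (by omega) (by omega)]
        simp
      have h1 : x (0 + 1) = -p := by simpa using ih 1 (by omega) (by omega)
      rw [hz, h0, h1] at hr
      have hne : ((k + 2 : ℕ) : A) ≠ 0 := Nat.cast_ne_zero.2 (by omega)
      have hp : p ^ (k + 2 - 0) = p * p ^ (k + 2 - (0 + 1)) := by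
        rw [← pow_succ']; congr 1
      have : ((k + 2 : ℕ) : A) * x (k + 2) = 0 := by rw [hr, hp]; ring
      simpa using (mul_eq_zero.1 this).resolve_left hne

theorem coeff_natCast_mul_geomTail (a : Fin s → A) (U : ReducedClass s) (k : ℕ) :
    coeff k ((U.len : PowerSeries A) * geomTail (mono a U.spec) U.len) =
      if k ≠ 0 ∧ U.len ∣ k then (U.len : A) * mono a U.spec ^ (k / U.len) else 0 := by
  rw [← map_natCast (C : A →+* PowerSeries A), coeff_C_mul, geomTail, coeff_mk, mul_ite, mul_zero]

theorem coeff_sum_geomTail (a : Fin s → A) {L k : ℕ} (hk : k ≤ L) :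
    coeff k (∑ U ∈ ReducedClass.upTo s L,
      (U.len : PowerSeries A) * geomTail (mono a U.spec) U.len) =
      if k = 0 then 0 else (∑ i, a i) ^ k := by
  rw [map_sum, Finset.sum_congr rfl fun U _ => coeff_natCast_mul_geomTail a U k]
  by_cases h0 : k = 0
  · simp [h0]
  · rw [if_neg h0, pow_sum_eq_sum_classes a (Nat.pos_of_ne_zero h0) hk, Finset.sum_filter]
    simp [h0]

theorem coeff_zero_eulerProd (a : Fin s → A) (L : ℕ) : coeff 0 (eulerProd a L) = 1 := by
  rw [eulerProd, coeff_zero_eq_constantCoeff, map_prod]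
  refine Finset.prod_eq_one fun U _ => ?_
  simp [U.len_pos.ne']

/-- Comparing coefficients in the formula for the logarithmic derivative of the Euler product. -/
theorem eulerProd_recursion (a : Fin s → A) {L k : ℕ} (h1 : 1 ≤ k) (hk : k ≤ L) :
    (k : A) * coeff k (eulerProd a L) =
      -∑ i ∈ Finset.range k, coeff i (eulerProd a L) * (∑ i, a i) ^ (k - i) := by
  have hD := X_mul_derivative_prod (ReducedClass.upTo s L) (fun U => mono a U.spec)
    ReducedClass.len fun U => U.len_pos
  rw [← eulerProd] at hD
  have h := congrArg (coeff k) hD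
  obtain ⟨j, rfl⟩ : ∃ j, k = j + 1 := ⟨k - 1, by omega⟩
  rw [coeff_succ_X_mul, coeff_derivative, map_neg, coeff_mul,
    Finset.Nat.sum_antidiagonal_eq_sum_range_succ_mk, Finset.sum_range_succ] at h
  push_cast
  rw [mul_comm, h]
  congr 1
  simp only [Nat.sub_self]
  rw [coeff_sum_geomTail a (Nat.zero_le L), if_pos rfl, mul_zero, add_zero]
  refine Finset.sum_congr rfl fun i hi => ?_
  rw [Finset.mem_range] at hi
  rw [coeff_sum_geomTail a (by omega), if_neg (by omega)]

theorem coeff_one_sub_C_mul_X (p : A) (k : ℕ) : coeff k (1 - C p * X : PowerSeries A) =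
    if k = 0 then 1 else if k = 1 then -p else 0 := by
  rw [map_sub, coeff_one, coeff_C_mul, coeff_X]
  rcases k with _ | _ | k <;> simp

theorem map_eulerProd {B : Type*} [CommRing B] (g : A →+* B) (a : Fin s → A) (L : ℕ) :
    PowerSeries.map g (eulerProd a L) = eulerProd (fun i => g (a i)) L := by
  simp [eulerProd, mono, map_prod]

/-- The cyclotomic identity `∏_U (1 - a^U z^{|U|}) = 1 - (∑ a_i) z` up to degree `L`. In
characteristic zero both sides have the same logarithmic derivative, because the words of length
`k` are the powers of the reduced words whose length divides `k`; the general case follows by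
specializing indeterminates. -/
theorem coeff_eulerProd (a : Fin s → A) {L k : ℕ} (hk : k ≤ L) :
    coeff k (eulerProd a L) = coeff k (1 - C (∑ i, a i) * X : PowerSeries A) := by
  let g : MvPolynomial (Fin s) ℤ →+* A := (MvPolynomial.aeval a : _ →ₐ[ℤ] A)
  have hg : (fun i => g (MvPolynomial.X i)) = a := by
    funext i
    exact MvPolynomial.aeval_X a i
  have h := eq_of_newton_recursion
    (fun k => coeff k (eulerProd (MvPolynomial.X : Fin s → MvPolynomial (Fin s) ℤ) L))
    (∑ i, MvPolynomial.X i) L (coeff_zero_eulerProd _ _)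
    (fun k h1 hk => eulerProd_recursion _ h1 hk) k hk
  have h2 := congrArg g h
  beta_reduce at h2
  rw [← PowerSeries.coeff_map, map_eulerProd, hg] at h2
  rw [h2, coeff_one_sub_C_mul_X, apply_ite g, apply_ite g, map_one, map_neg, map_zero, map_sum]
  simp only [← hg]

end Cyclotomic

/-! ### Amitsur's formula -/

section ClassIndex

variable {s : ℕ}

/-- The product of the classes with multiplicities `f` has multidegree `∑ f(U) spec(U)`. -/
noncomputable def totalSpec (f : ReducedClass s →₀ ℕ) : Fin s →₀ ℕ := f.sum fun U r => r • U.spec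

theorem degree_totalSpec (f : ReducedClass s →₀ ℕ) :
    (totalSpec f).degree = f.sum fun U r => r * U.len := by
  rw [totalSpec, Finsupp.sum, map_sum, Finsupp.sum]
  simp [ReducedClass.degree_spec]

theorem mul_len_le_degree (f : ReducedClass s →₀ ℕ) (U : ReducedClass s) :
    f U * U.len ≤ (totalSpec f).degree := by
  rw [degree_totalSpec]
  by_cases h : U ∈ f.support
  · exact Finset.single_le_sum (f := fun U => f U * U.len) (fun _ _ => Nat.zero_le _) h
  · simp [Finsupp.notMem_support_iff.1 h]

/-- The bounds `|U| ≤ L` and `f(U) < N` are automatic when the total multidegree is `α`. -/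
theorem filter_finsupp_eq (α : Fin s →₀ ℕ) {L N : ℕ} (hL : α.degree = L) (hN : L < N)
    (f : ReducedClass s →₀ ℕ) :
    f ∈ ((ReducedClass.upTo s L).finsupp fun _ => Finset.range N).filter (fun f => totalSpec f = α) ↔
      totalSpec f = α := by
  rw [Finset.mem_filter, and_iff_right_iff_imp]
  rintro rfl
  have h := mul_len_le_degree f
  rw [Finset.mem_finsupp_iff]
  refine ⟨fun U hU => ?_, fun U _ => ?_⟩
  · have h1 : f U ≠ 0 := Finsupp.mem_support_iff.1 hU
    rw [ReducedClass.mem_upTo, ← hL]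
    exact (Nat.le_mul_of_pos_left _ (Nat.pos_of_ne_zero h1)).trans (h U)
  · rw [Finset.mem_range]
    exact ((Nat.le_mul_of_pos_right _ U.len_pos).trans (h U)).trans_lt (hL ▸ hN)

/-- The multiplicity functions `f` of classes of reduced words of total multidegree `α`. -/
noncomputable def classIndex (α : Fin s →₀ ℕ) : Finset (ReducedClass s →₀ ℕ) :=
  ((ReducedClass.upTo s α.degree).finsupp fun _ => Finset.range (α.degree + 1)).filter
    (fun f => totalSpec f = α)

@[simp] theorem mem_classIndex {α : Fin s →₀ ℕ} {f : ReducedClass s →₀ ℕ} :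
    f ∈ classIndex α ↔ totalSpec f = α := filter_finsupp_eq α rfl (Nat.lt_succ_self _) f

/-- The multiset of pairs (multiplicity, commutative image) attached to `f`. -/
noncomputable def pairType (f : ReducedClass s →₀ ℕ) : Multiset (ℕ × (Fin s →₀ ℕ)) :=
  f.support.val.map fun U => (f U, U.spec)

theorem pairType_mem (f : ReducedClass s →₀ ℕ) (α : Fin s →₀ ℕ) :
    pairType f ∈ amitsurIndex α ↔ totalSpec f = α := by
  have h1 : ∀ p ∈ pairType f, p.1 ≠ 0 ∧ p.2 ≠ 0 := by
    intro p hp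
    obtain ⟨U, hU, rfl⟩ := Multiset.mem_map.1 hp
    exact ⟨Finsupp.mem_support_iff.1 hU, U.spec_ne_zero⟩
  have h2 : ((pairType f).map fun p => p.1 • p.2).sum = totalSpec f := by
    rw [pairType, Multiset.map_map]
    rfl
  rw [← h2]
  exact ⟨fun h => h.2, fun h => ⟨h1, h⟩⟩

/-- The elements `S^α` as sums over multiplicity functions on classes of reduced words. -/
theorem amitsurS_eq_sum (K : Type*) [CommRing K] (n : ℕ) {m : ℕ} (α : Fin s →₀ ℕ)
    (w : Fin s → (Fin m →₀ ℕ)) :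
    amitsurS K n α w = ∑ f ∈ classIndex α,
      (-1) ^ (α.degree + f.degree) * f.prod fun U r => e K n r (subst w U.spec) := by
  classical
  have hmap : ∀ f ∈ classIndex α, pairType f ∈ (amitsurIndex_finite α).toFinset := by
    intro f hf
    rw [Set.Finite.mem_toFinset, pairType_mem]
    exact mem_classIndex.1 hf
  rw [← Finset.sum_fiberwise_of_maps_to hmap, amitsurS]
  refine Finset.sum_congr rfl fun P hP => ?_
  have hcard : amitsurC P = ((classIndex α).filter fun f => pairType f = P).card := by
    refine Nat.subtype_card _ fun f => ?_
    rw [Finset.mem_filter, mem_classIndex]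
    refine ⟨fun h => h.2, fun h => ⟨?_, h⟩⟩
    rw [← pairType_mem]
    change pairType f = P at h
    rw [h]
    exact (Set.Finite.mem_toFinset _).1 hP
  rw [hcard, mul_right_comm, mul_comm, ← nsmul_eq_mul, ← Finset.sum_const]
  refine Finset.sum_congr rfl fun f hf => ?_
  obtain ⟨_, rfl⟩ := Finset.mem_filter.1 hf
  congr 1
  · rw [Finsupp.degree_eq_sum, pairType, Multiset.map_map, Finsupp.degree_apply]
    rfl
  · rw [pairType, Multiset.map_map]
    rfl

end ClassIndex

section Amitsur

variable {K : Type*} [CommRing K] {n m s : ℕ}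

theorem sigma_zero (w : Fin m →₀ ℕ) : sigma K n 0 w = 1 := by simp [sigma]

theorem sigma_of_lt {r : ℕ} (hr : n < r) (w : Fin m →₀ ℕ) : sigma K n r w = 0 := by
  rw [sigma, Finset.powersetCard_eq_empty.2 (by simpa using hr), Finset.sum_empty]

theorem e_of_lt {r : ℕ} (hr : n < r) (w : Fin m →₀ ℕ) : e K n r w = 0 :=
  dif_neg (by omega)

theorem coe_phi_e {r : ℕ} (hr : 1 ≤ r) {w : Fin m →₀ ℕ} (hw : w ≠ 0) :
    (phi K n m (e K n r w) : MvPolynomial (Fin m × Fin n) K) = sigma K n r w := by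
  by_cases h : r ≤ n
  · rw [e, dif_pos ⟨⟨hr, h⟩, hw⟩, phi, MvPolynomial.aeval_X]
  · rw [e_of_lt (by omega), sigma_of_lt (by omega), map_zero]
    rfl

theorem subst_ne_zero {w : Fin s → (Fin m →₀ ℕ)} (hw : ∀ i, w i ≠ 0) {u : Fin s →₀ ℕ}
    (hu : u ≠ 0) : subst w u ≠ 0 := by
  obtain ⟨i, hi⟩ := Finsupp.ne_iff.1 hu
  obtain ⟨k, hk⟩ := Finsupp.ne_iff.1 (hw i)
  refine Finsupp.ne_iff.2 ⟨k, ?_⟩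
  simp only [Finsupp.coe_zero, Pi.zero_apply] at hi hk ⊢
  rw [subst, Finsupp.finsetSum_apply]
  refine (Finset.sum_pos' (fun _ _ => Nat.zero_le _) ⟨i, Finset.mem_univ _, ?_⟩).ne'
  simpa [Nat.pos_iff_ne_zero] using ⟨hi, hk⟩

theorem place_zero (j : Fin n) : place K (0 : Fin m →₀ ℕ) j = 1 := by simp [place]

theorem place_add (u v : Fin m →₀ ℕ) (j : Fin n) :
    place K (u + v) j = place K u j * place K v j := by
  simp [place, pow_add, Finset.prod_mul_distrib]

theorem place_nsmul (k : ℕ) (u : Fin m →₀ ℕ) (j : Fin n) :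
    place K (k • u) j = place K u j ^ k := by
  simp [place, pow_mul', Finset.prod_pow]

theorem place_subst (w : Fin s → (Fin m →₀ ℕ)) (u : Fin s →₀ ℕ) (j : Fin n) :
    place K (subst w u) j = mono (fun i => place K (w i) j) u := by
  have h : ∀ S : Finset (Fin s), place K (∑ i ∈ S, u i • w i) j =
      ∏ i ∈ S, place K (w i) j ^ u i := by
    classical
    intro S
    induction S using Finset.induction_on with
    | empty => simp [place_zero]
    | insert i S hi ih => rw [Finset.sum_insert hi, Finset.prod_insert hi, place_add, ih, place_nsmul]
  exact h _

theorem prod_monomial {ι σ R : Type*} [CommSemiring R] (S : Finset ι) (u : ι → σ →₀ ℕ) (c : ι → R) :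
    ∏ i ∈ S, MvPolynomial.monomial (u i) (c i) =
      MvPolynomial.monomial (∑ i ∈ S, u i) (∏ i ∈ S, c i) := by
  classical
  induction S using Finset.induction_on with
  | empty => rfl
  | insert i S hi ih =>
    rw [Finset.prod_insert hi, Finset.sum_insert hi, Finset.prod_insert hi, ih,
      MvPolynomial.monomial_mul]

theorem prod_sum_eq_sum_finsupp {ι A : Type*} [CommSemiring A] (S : Finset ι) (t : Finset ℕ)
    (g : ι → ℕ → A) :
    ∏ i ∈ S, ∑ r ∈ t, g i r = ∑ f ∈ S.finsupp fun _ => t, ∏ i ∈ S, g i (f i) := by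
  classical
  rw [Finset.prod_sum, Finset.finsupp, Finset.sum_map]
  refine Finset.sum_congr rfl fun p _ => ?_
  rw [← Finset.prod_attach S]
  refine Finset.prod_congr rfl fun i _ => ?_
  simp [Finsupp.indicator_of_mem i.2]

theorem prod_one_sub_eq_sum {ι A : Type*} [Fintype ι] [CommRing A] (x : ι → A) {N : ℕ}
    (hN : Fintype.card ι < N) :
    ∏ j, (1 - x j) = ∑ r ∈ Finset.range N,
      (-1) ^ r * ∑ I ∈ Finset.univ.powersetCard r, ∏ j ∈ I, x j := by
  classical
  have h := Finset.prod_one_add (f := fun j => -x j) (Finset.univ : Finset ι)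
  simp only [← sub_eq_add_neg] at h
  rw [h, Finset.sum_powerset, Finset.card_univ]
  have hsub : Finset.range (Fintype.card ι + 1) ⊆ Finset.range N :=
    Finset.range_subset_range.2 hN
  rw [← Finset.sum_subset hsub]
  · refine Finset.sum_congr rfl fun r _ => ?_
    rw [Finset.mul_sum]
    refine Finset.sum_congr rfl fun I hI => ?_
    rw [Finset.prod_neg, (Finset.mem_powersetCard.1 hI).2]
  · intro r _ hr
    rw [Finset.mem_range, not_lt] at hr
    rw [Finset.powersetCard_eq_empty.2 (by simpa using hr), Finset.sum_empty, mul_zero]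

open PowerSeries in
theorem coeff_prod_congr {ι A : Type*} [CommRing A] (S : Finset ι) (F G : ι → PowerSeries A) {L : ℕ}
    (h : ∀ i ∈ S, ∀ k ≤ L, coeff k (F i) = coeff k (G i)) :
    ∀ k ≤ L, coeff k (∏ i ∈ S, F i) = coeff k (∏ i ∈ S, G i) := by
  classical
  induction S using Finset.induction_on with
  | empty => simp
  | insert i S hi ih =>
    intro k hk
    rw [Finset.prod_insert hi, Finset.prod_insert hi, coeff_mul, coeff_mul]
    refine Finset.sum_congr rfl fun x hx => ?_
    rw [Finset.HasAntidiagonal.mem_antidiagonal] at hx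
    rw [h i (Finset.mem_insert_self _ _) _ (by omega),
      ih (fun j hj => h j (Finset.mem_insert_of_mem hj)) _ (by omega)]

open PowerSeries in
theorem coeff_prod_one_sub {A : Type*} [CommRing A] (p : Fin n → A) (L : ℕ) :
    coeff L (∏ j, (1 - C (p j) * X : PowerSeries A)) =
      (-1) ^ L * ∑ I ∈ Finset.univ.powersetCard L, ∏ j ∈ I, p j := by
  rw [prod_one_sub_eq_sum (N := n + L + 1) _ (by rw [Fintype.card_fin]; omega), map_sum]
  have h : ∀ r, (-1) ^ r * ∑ I ∈ (Finset.univ : Finset (Fin n)).powersetCard r,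
      ∏ j ∈ I, (C (p j) * X : PowerSeries A) =
      C ((-1) ^ r * ∑ I ∈ (Finset.univ : Finset (Fin n)).powersetCard r, ∏ j ∈ I, p j) * X ^ r := by
    intro r
    rw [map_mul, map_pow, map_neg, map_one, map_sum, mul_assoc, Finset.sum_mul]
    congr 1
    refine Finset.sum_congr rfl fun I hI => ?_
    rw [Finset.prod_mul_distrib, Finset.prod_const, (Finset.mem_powersetCard.1 hI).2, map_prod]
  simp only [h, coeff_C_mul, coeff_X_pow]
  simp

/-- The `j`-th diagonal entry `∑ t_i (w_i)_⟨j⟩` of the generic linear combination `∑ t_i w_i`. -/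
noncomputable def genericEntry (K : Type*) [CommRing K] {n m s : ℕ} (w : Fin s → (Fin m →₀ ℕ))
    (j : Fin n) : MvPolynomial (Fin s) (MvPolynomial (Fin m × Fin n) K) :=
  ∑ i, MvPolynomial.monomial (Finsupp.single i 1) (place K (w i) j)

theorem mono_monomial {R : Type*} [CommRing R] (a : Fin s → R) (u : Fin s →₀ ℕ) :
    mono (fun i => MvPolynomial.monomial (Finsupp.single i 1) (a i)) u =
      MvPolynomial.monomial u (mono a u) := by
  classical
  simp only [mono, MvPolynomial.monomial_pow, prod_monomial]
  congr 1
  ext i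
  simp

open PowerSeries in
/-- The product of the Euler products over all places, expanded in the elements `σ_r`. -/
theorem coeff_prod_eulerProd (w : Fin s → (Fin m →₀ ℕ)) (α : Fin s →₀ ℕ) :
    MvPolynomial.coeff α (coeff α.degree (∏ j : Fin n, eulerProd
      (fun i => MvPolynomial.monomial (Finsupp.single i 1) (place K (w i) j)) α.degree)) =
    ∑ f ∈ classIndex α, f.prod fun U r => (-1) ^ r * sigma K n r (subst w U.spec) := by
  classical
  set L := α.degree with hL
  set N := n + L + 1 with hN
  have hfac : ∀ U : ReducedClass s, ∏ j : Fin n,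
      (1 - C (mono (fun i => MvPolynomial.monomial (Finsupp.single i 1) (place K (w i) j)) U.spec)
        * X ^ U.len : PowerSeries (MvPolynomial (Fin s) (MvPolynomial (Fin m × Fin n) K))) =
      ∑ r ∈ Finset.range N, C (MvPolynomial.monomial (r • U.spec)
        ((-1) ^ r * sigma K n r (subst w U.spec))) * X ^ (r * U.len) := by
    intro U
    rw [prod_one_sub_eq_sum (N := N) _ (by rw [Fintype.card_fin]; omega)]
    refine Finset.sum_congr rfl fun r _ => ?_
    have hs : MvPolynomial.monomial (r • U.spec) ((-1) ^ r * sigma K n r (subst w U.spec)) =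
        (-1) ^ r * ∑ I ∈ (Finset.univ : Finset (Fin n)).powersetCard r, ∏ j ∈ I,
          MvPolynomial.monomial U.spec (place K (subst w U.spec) j) := by
      have h1 : ((-1) ^ r : MvPolynomial (Fin s) (MvPolynomial (Fin m × Fin n) K)) =
          MvPolynomial.C ((-1) ^ r) := by simp
      rw [h1, ← MvPolynomial.C_mul_monomial, sigma, map_sum]
      congr 1
      refine Finset.sum_congr rfl fun I hI => ?_
      rw [prod_monomial, Finset.sum_const, (Finset.mem_powersetCard.1 hI).2]
    rw [hs, map_mul, map_pow, map_neg, map_one, map_sum, mul_assoc, Finset.sum_mul]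
    congr 1
    refine Finset.sum_congr rfl fun I hI => ?_
    simp only [mono_monomial, ← place_subst]
    rw [Finset.prod_mul_distrib, Finset.prod_const, (Finset.mem_powersetCard.1 hI).2, map_prod,
      ← pow_mul, mul_comm r]
  simp only [eulerProd]
  rw [Finset.prod_comm, Finset.prod_congr rfl fun U _ => hfac U, prod_sum_eq_sum_finsupp,
    map_sum, MvPolynomial.coeff_sum]
  have hterm : ∀ f ∈ (ReducedClass.upTo s L).finsupp fun _ => Finset.range N,
      MvPolynomial.coeff α (coeff L (∏ U ∈ ReducedClass.upTo s L,
        C (MvPolynomial.monomial (f U • U.spec)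
          ((-1) ^ f U * sigma K n (f U) (subst w U.spec))) * X ^ (f U * U.len))) =
      if totalSpec f = α then f.prod fun U r => (-1) ^ r * sigma K n r (subst w U.spec) else 0 := by
    intro f hf
    have hsupp := (Finset.mem_finsupp_iff.1 hf).1
    have h1 : ∑ U ∈ ReducedClass.upTo s L, f U • U.spec = totalSpec f :=
      (Finsupp.sum_of_support_subset f hsupp (fun U r => r • U.spec) (by simp)).symm
    have h2 : ∑ U ∈ ReducedClass.upTo s L, f U * U.len = (totalSpec f).degree := by
      rw [degree_totalSpec]
      exact (Finsupp.sum_of_support_subset f hsupp (fun U r => r * U.len) (by simp)).symm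
    have h3 : ∏ U ∈ ReducedClass.upTo s L, ((-1) ^ f U * sigma K n (f U) (subst w U.spec)) =
        f.prod fun U r => (-1) ^ r * sigma K n r (subst w U.spec) :=
      (Finsupp.prod_of_support_subset f hsupp
        (fun U r => (-1) ^ r * sigma K n r (subst w U.spec)) (by simp [sigma_zero])).symm
    rw [Finset.prod_mul_distrib, ← map_prod, prod_monomial, Finset.prod_pow_eq_pow_sum, h1, h2, h3,
      coeff_C_mul, coeff_X_pow]
    by_cases hα : totalSpec f = α
    · rw [if_pos hα, hα, if_pos rfl, mul_one, MvPolynomial.coeff_monomial, if_pos rfl]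
    · rw [if_neg hα]
      split_ifs
      · rw [mul_one, MvPolynomial.coeff_monomial, if_neg hα]
      · simp
  rw [Finset.sum_congr rfl hterm, ← Finset.sum_filter]
  refine Finset.sum_congr ?_ fun _ _ => rfl
  ext f
  rw [filter_finsupp_eq α hL.symm (by omega), mem_classIndex]

/-- Amitsur's formula: `S^α(w)` maps to the coefficient of `t^α` in `σ_l(∑ t_i w_i)`,
where `l = |α|`. -/
theorem coe_phi_amitsurS {w : Fin s → (Fin m →₀ ℕ)} (hw : ∀ i, w i ≠ 0) (α : Fin s →₀ ℕ) :
    (phi K n m (amitsurS K n α w) : MvPolynomial (Fin m × Fin n) K) =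
      MvPolynomial.coeff α (∑ I ∈ (Finset.univ : Finset (Fin n)).powersetCard α.degree,
        ∏ j ∈ I, genericEntry K w j) := by
  have h1 := coeff_prod_eulerProd (K := K) (n := n) w α
  rw [coeff_prod_congr Finset.univ _ (fun j : Fin n => 1 - PowerSeries.C (genericEntry K w j) *
    PowerSeries.X) (fun j _ k hk => coeff_eulerProd _ hk) _ le_rfl, coeff_prod_one_sub] at h1
  have h2 : ((-1) ^ α.degree : MvPolynomial (Fin s) (MvPolynomial (Fin m × Fin n) K)) =
      MvPolynomial.C ((-1) ^ α.degree) := by simp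
  rw [h2, MvPolynomial.coeff_C_mul] at h1
  have h3 : (phi K n m (amitsurS K n α w) : MvPolynomial (Fin m × Fin n) K) =
      (-1) ^ α.degree * ∑ f ∈ classIndex α,
        f.prod fun U r => (-1) ^ r * sigma K n r (subst w U.spec) := by
    rw [amitsurS_eq_sum, map_sum, AddSubmonoidClass.coe_finsetSum, Finset.mul_sum]
    refine Finset.sum_congr rfl fun f _ => ?_
    rw [map_mul, map_pow, map_neg, map_one, Finsupp.prod, map_prod]
    push_cast
    rw [pow_add, mul_assoc, Finsupp.prod, Finset.prod_mul_distrib, Finset.prod_pow_eq_pow_sum,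
      Finsupp.degree_apply]
    congr 2
    refine Finset.prod_congr rfl fun U hU => ?_
    exact coe_phi_e (Nat.pos_of_ne_zero (Finsupp.mem_support_iff.1 hU))
      (subst_ne_zero hw U.spec_ne_zero)
  rw [h3, ← h1, ← mul_assoc, ← mul_pow]
  simp

theorem phi_amitsurS_of_lt {w : Fin s → (Fin m →₀ ℕ)} (hw : ∀ i, w i ≠ 0) {α : Fin s →₀ ℕ}
    (hα : n < α.degree) : phi K n m (amitsurS K n α w) = 0 := by
  apply Subtype.ext
  rw [coe_phi_amitsurS hw, Finset.powersetCard_eq_empty.2 (by simpa using hα), Finset.sum_empty]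
  rfl

/-- If all the monomials `w_i` agree, `S^α(w)` maps to a multiple of `σ_l(w)` (the factor being
a multinomial coefficient). -/
theorem exists_phi_amitsurS_const (n : ℕ) {u : Fin m →₀ ℕ} (hu : u ≠ 0) (α : Fin s →₀ ℕ) :
    ∃ c : ℕ, (phi K n m (amitsurS K n α fun _ => u) : MvPolynomial (Fin m × Fin n) K) =
      c * sigma K n α.degree u := by
  refine ⟨MvPolynomial.coeff α ((∑ i, MvPolynomial.X i : MvPolynomial (Fin s) ℕ) ^ α.degree), ?_⟩
  have h1 : ∀ j : Fin n, genericEntry K (fun _ : Fin s => u) j = MvPolynomial.C (place K u j) *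
      MvPolynomial.map (Nat.castRingHom _) (∑ i, MvPolynomial.X i : MvPolynomial (Fin s) ℕ) := by
    intro j
    rw [genericEntry, map_sum, Finset.mul_sum]
    refine Finset.sum_congr rfl fun i _ => ?_
    rw [MvPolynomial.map_X, MvPolynomial.C_mul_X_eq_monomial]
  have h2 : ∑ I ∈ (Finset.univ : Finset (Fin n)).powersetCard α.degree,
      ∏ j ∈ I, genericEntry K (fun _ : Fin s => u) j =
      MvPolynomial.C (sigma K n α.degree u) * MvPolynomial.map (Nat.castRingHom _)
        ((∑ i, MvPolynomial.X i : MvPolynomial (Fin s) ℕ) ^ α.degree) := by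
    rw [sigma, map_sum, Finset.sum_mul]
    refine Finset.sum_congr rfl fun I hI => ?_
    simp only [h1]
    rw [Finset.prod_mul_distrib, Finset.prod_const, (Finset.mem_powersetCard.1 hI).2, map_prod,
      map_pow]
  rw [coe_phi_amitsurS (fun _ => hu), h2, MvPolynomial.coeff_C_mul, MvPolynomial.coeff_map, mul_comm]
  rfl

end Amitsur

/-! ### The ideal of relations and the powers of one monomial -/

section Relations

variable (K : Type*) [CommRing K] (n m : ℕ)

/-- The ideal generated by the listed elements `S^α(w_1, …, w_s)` and `Q_{r,k}(w)`. -/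
noncomputable def relIdeal : Ideal (ERing K n m) :=
  Ideal.span
    ({S | ∃ (s : ℕ) (α : Fin s →₀ ℕ) (w : Fin s → (Fin m →₀ ℕ)),
        2 ≤ s ∧ (∀ i, w i ≠ 0) ∧ n < ∑ i, α i ∧
        (∀ j, ∑ i ∈ Finset.univ.erase j, α i ≤ n) ∧
        S = amitsurS K n α w} ∪
      {q | ∃ (r k : ℕ) (w : Fin m →₀ ℕ),
        1 ≤ r ∧ r ≤ n ∧ 2 ≤ k ∧ (k : ℚ) < 1 + (n : ℚ) / (r : ℚ) ∧ w ≠ 0 ∧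
        q = Q K n r k w})

variable {K n m}

theorem amitsurS_mem_relIdeal {s : ℕ} (hs : 2 ≤ s) {α : Fin s →₀ ℕ} {w : Fin s → (Fin m →₀ ℕ)}
    (hw : ∀ i, w i ≠ 0) (h1 : n < ∑ i, α i) (h2 : ∀ j, ∑ i ∈ Finset.univ.erase j, α i ≤ n) :
    amitsurS K n α w ∈ relIdeal K n m :=
  Ideal.subset_span (Or.inl ⟨s, α, w, hs, hw, h1, h2, rfl⟩)

theorem sigma_eq_aeval_esymm (r : ℕ) (w : Fin m →₀ ℕ) :
    sigma K n r w = MvPolynomial.aeval (place K w) (MvPolynomial.esymm (Fin n) K r) := by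
  simp [sigma, MvPolynomial.esymm, map_sum, map_prod]

theorem nsmul_ne_zero {k : ℕ} (hk : 1 ≤ k) {w : Fin m →₀ ℕ} (hw : w ≠ 0) : k • w ≠ 0 :=
  fun h => (smul_eq_zero.1 h).elim (by omega) hw

theorem phi_Q {r k : ℕ} (hr : 1 ≤ r) (hk : 1 ≤ k) {w : Fin m →₀ ℕ} (hw : w ≠ 0) :
    phi K n m (Q K n r k w) = 0 := by
  apply Subtype.ext
  have hf : MvPolynomial.aeval (fun i : Fin n => sigmaPow n (i + 1) 1) (fpoly n r k) =
    sigmaPow n r k := (existsUnique_sigmaPow n r k).choose_spec.1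
  have hs : ∀ r k, MvPolynomial.aeval (place K w) (sigmaPow n r k) = sigma K n r (k • w) := by
    intro r k
    simp [sigmaPow, sigma, map_sum, map_prod, place_nsmul]
  have h1 : (((phi K n m).restrictScalars ℤ (MvPolynomial.aeval (fun i : Fin n => e K n (i + 1) w)
      (fpoly n r k)) : multisymmetric K n m) : MvPolynomial (Fin m × Fin n) K) =
      MvPolynomial.aeval (place K w) (MvPolynomial.aeval (fun i : Fin n => sigmaPow n (i + 1) 1)
        (fpoly n r k)) := by
    generalize fpoly n r k = p
    induction p using MvPolynomial.induction_on with
    | C a => simp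
    | add p q hp hq => simp only [map_add, ← hp, ← hq]; rfl
    | mul_X p i hp =>
      simp only [map_mul, ← hp, MvPolynomial.aeval_X, hs, one_smul]
      rw [MulMemClass.coe_mul]
      congr 1
      exact coe_phi_e (Nat.succ_pos _) hw
  rw [hf, hs] at h1
  rw [Q, map_sub, AddSubgroupClass.coe_sub, coe_phi_e hr (nsmul_ne_zero hk hw)]
  rw [← h1]
  exact sub_self _

theorem relIdeal_le_ker : relIdeal K n m ≤ RingHom.ker (phi K n m) := by
  refine Ideal.span_le.2 ?_
  rintro x (⟨s, α, w, -, hw, h, -, rfl⟩ | ⟨r, k, w, hr, -, hk, -, hw, rfl⟩)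
  · exact phi_amitsurS_of_lt hw (by rwa [Finsupp.degree_eq_sum])
  · exact phi_Q hr (by omega) hw

/-- The elements `σ_1(w), …, σ_n(w)` are algebraically independent when `w ≠ 1`. -/
theorem aeval_sigma_injective {w : Fin m →₀ ℕ} (hw : w ≠ 0) :
    Function.Injective (MvPolynomial.aeval (R := K) fun i : Fin n => sigma K n (i + 1) w) := by
  have hplace : Function.Injective (MvPolynomial.aeval (R := K) (place K (n := n) w)) := by
    obtain ⟨i, hi⟩ := Finsupp.ne_iff.1 hw
    -- sending the other variables to `1` turns `w_⟨j⟩` into a power of the `j`-th variable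
    let g : MvPolynomial (Fin m × Fin n) K →ₐ[K] MvPolynomial (Fin n) K :=
      MvPolynomial.aeval fun q => if q.1 = i then MvPolynomial.X q.2 else 1
    have hcomp : g.comp (MvPolynomial.aeval (R := K) (place K (n := n) w)) =
        MvPolynomial.expand (w i) := by
      apply MvPolynomial.algHom_ext
      intro j
      simp only [AlgHom.comp_apply, MvPolynomial.aeval_X, place, map_prod, map_pow, g,
        MvPolynomial.expand_X]
      rw [Finset.prod_eq_single i]
      · simp
      · intro i' _ hne
        simp [hne]
      · simp
    have hinj : Function.Injective (g.comp (MvPolynomial.aeval (R := K) (place K (n := n) w))) := by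
      rw [hcomp]
      exact MvPolynomial.expand_injective (Nat.pos_of_ne_zero hi)
    exact Function.Injective.of_comp (f := g) hinj
  have hes : Function.Injective
      (MvPolynomial.aeval (R := K) fun i : Fin n => MvPolynomial.esymm (Fin n) K (i + 1)) := by
    intro p q hpq
    apply (MvPolynomial.esymmAlgHom_fin_bijective K n).1
    apply Subtype.ext
    rw [MvPolynomial.esymmAlgHom_apply, MvPolynomial.esymmAlgHom_apply]
    exact hpq
  have hE : MvPolynomial.aeval (R := K) (fun i : Fin n => sigma K n (i + 1) w) =
      (MvPolynomial.aeval (R := K) (place K (n := n) w)).comp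
        (MvPolynomial.aeval fun i : Fin n => MvPolynomial.esymm (Fin n) K (i + 1)) := by
    apply MvPolynomial.algHom_ext
    intro i
    simp [sigma_eq_aeval_esymm]
  rw [hE]
  exact hplace.comp hes

/-- The elements congruent, modulo the relations, to a polynomial in `e_1(w), …, e_n(w)`. -/
noncomputable def polyIn (K : Type*) [CommRing K] (n : ℕ) {m : ℕ} (w : Fin m →₀ ℕ) :
    Subalgebra K (ERing K n m) :=
  ((MvPolynomial.aeval (R := K) fun i : Fin n => e K n (i + 1) w).range.map
    (Ideal.Quotient.mkₐ K (relIdeal K n m))).comap (Ideal.Quotient.mkₐ K (relIdeal K n m))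

theorem mem_polyIn {w : Fin m →₀ ℕ} {x : ERing K n m} : x ∈ polyIn K n w ↔
    ∃ g, x - MvPolynomial.aeval (R := K) (fun i : Fin n => e K n (i + 1) w) g ∈ relIdeal K n m := by
  rw [polyIn, Subalgebra.mem_comap, Subalgebra.mem_map]
  constructor
  · rintro ⟨y, ⟨g, rfl⟩, h⟩
    exact ⟨g, Ideal.Quotient.eq.1 h.symm⟩
  · rintro ⟨g, h⟩
    exact ⟨_, ⟨g, rfl⟩, (Ideal.Quotient.eq.2 h).symm⟩

theorem mem_polyIn_of_mem_relIdeal (w : Fin m →₀ ℕ) {x : ERing K n m} (hx : x ∈ relIdeal K n m) :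
    x ∈ polyIn K n w := mem_polyIn.2 ⟨0, by simpa using hx⟩

theorem e_mem_polyIn (w : Fin m →₀ ℕ) {r : ℕ} (hr : 1 ≤ r) : e K n r w ∈ polyIn K n w := by
  by_cases h : r ≤ n
  · refine mem_polyIn.2 ⟨MvPolynomial.X ⟨r - 1, by omega⟩, ?_⟩
    have : r - 1 + 1 = r := by omega
    simp [this]
  · rw [e_of_lt (by omega)]
    exact zero_mem _

/-- The elements of `ker φ` congruent to a polynomial in `e_1(w), …, e_n(w)` lie in the ideal, by
the algebraic independence of `σ_1(w), …, σ_n(w)`. -/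
theorem mem_relIdeal_of_mem_polyIn {w : Fin m →₀ ℕ} (hw : w ≠ 0) {x : ERing K n m}
    (hx : x ∈ polyIn K n w) (h0 : phi K n m x = 0) : x ∈ relIdeal K n m := by
  obtain ⟨g, hg⟩ := mem_polyIn.1 hx
  have h1 : phi K n m (MvPolynomial.aeval (R := K) (fun i : Fin n => e K n (i + 1) w) g) = 0 := by
    have := relIdeal_le_ker hg
    rwa [RingHom.mem_ker, map_sub, h0, zero_sub, neg_eq_zero] at this
  have h2 : MvPolynomial.aeval (R := K) (fun i : Fin n => sigma K n (i + 1) w) g = 0 := by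
    have h3 := congrArg (multisymmetric K n m).val h1
    rw [map_zero, ← AlgHom.comp_apply, ← AlgHom.comp_apply] at h3
    rw [← h3]
    congr 1
    apply MvPolynomial.algHom_ext
    intro i
    simp only [AlgHom.comp_apply, MvPolynomial.aeval_X]
    exact (coe_phi_e (Nat.succ_pos _) hw).symm
  have h3 : g = 0 := aeval_sigma_injective hw (by rw [h2, map_zero])
  simpa [h3] using hg

end Relations

section Elimination

variable {K : Type*} [CommRing K] {n m : ℕ}

theorem count_zero_add_count_one (V : List (Fin 2)) : V.count 0 + V.count 1 = V.length := by
  have := Multiset.sum_count_eq_card (s := Finset.univ) (m := (V : Multiset (Fin 2))) (by simp)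
  simpa using this

/-- The only reduced word in which the second of two letters does not occur is the first letter. -/
theorem spec_of_count_one_eq_zero {U : ReducedClass 2} (h : U.spec 1 = 0) : U.spec 0 = 1 := by
  rw [U.spec_apply] at h ⊢
  have hlen := count_zero_add_count_one U.rep
  rw [h, add_zero] at hlen
  have hrep : U.rep = wordPow [0] U.rep.length := by
    rw [List.count_eq_length] at hlen
    rw [wordPow, List.flatten_replicate_singleton, List.eq_replicate_iff]
    exact ⟨rfl, fun b hb => (hlen b hb).symm⟩
  have h2 : ¬ 2 ≤ U.rep.length := fun h2 => U.rep_reduced.2 _ _ h2 hrep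
  have := U.len_pos
  rw [ReducedClass.len] at this
  omega

/-- There is only one class of words with a single occurrence of the second letter and a given
number of occurrences of the first. -/
theorem eq_of_count_one_eq_one {U V : ReducedClass 2} (hU : U.spec 1 = 1) (hV : V.spec 1 = 1)
    (h0 : U.spec 0 = V.spec 0) : U = V := by
  have key : ∀ W : ReducedClass 2, W.spec 1 = 1 → W.rep ~r List.replicate (W.spec 0) 0 ++ [1] := by
    intro W hW
    rw [W.spec_apply] at hW ⊢
    have hmem : (1 : Fin 2) ∈ W.rep := List.count_pos_iff.1 (by omega)
    obtain ⟨l₁, l₂, hl⟩ := List.append_of_mem hmem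
    have hrot : W.rep ~r (l₂ ++ l₁) ++ [1] := by
      rw [hl, List.append_assoc]
      have := List.isRotated_append (l := l₁ ++ [1]) (l' := l₂)
      simpa using this
    have hc1 : (l₂ ++ l₁).count 1 = 0 := by
      have := hrot.perm.count_eq (1 : Fin 2)
      rw [hW] at this
      simp at this ⊢
      omega
    have hc0 : (l₂ ++ l₁).count 0 = W.rep.count 0 := by
      have := hrot.perm.count_eq (0 : Fin 2)
      rw [this]
      simp
    have hlen := count_zero_add_count_one (l₂ ++ l₁)
    have hE : l₂ ++ l₁ = List.replicate (W.rep.count 0) 0 := by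
      rw [List.eq_replicate_iff]
      refine ⟨by omega, fun b hb => ?_⟩
      rw [hc1, add_zero, List.count_eq_length] at hlen
      exact (hlen b hb).symm
    rwa [hE] at hrot
  have h1 := key U hU
  have h2 := key V hV
  rw [h0] at h1
  rw [← U.mk_rep, ← V.mk_rep, ReducedClass.mk_eq_iff]
  exact h1.trans h2.symm

theorem exists_class_count_one (i : ℕ) :
    ∃ U : ReducedClass 2, U.spec 0 = i ∧ U.spec 1 = 1 := by
  have hred : IsReducedWord (List.replicate i (0 : Fin 2) ++ [1]) := by
    refine ⟨by simp, fun V k hk h => ?_⟩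
    change _ = wordPow V k at h
    have h1 := congrArg (List.count (1 : Fin 2)) h
    rw [count_wordPow, List.count_append, List.count_replicate] at h1
    have := Nat.eq_one_of_mul_eq_one_right (m := k) (n := V.count 1) (by simpa using h1.symm)
    omega
  refine ⟨ReducedClass.mk _ hred, ?_, ?_⟩
  · rw [ReducedClass.spec_mk]; simp
  · rw [ReducedClass.spec_mk, List.count_append, List.count_replicate]; simp

theorem totalSpec_apply {s : ℕ} (f : ReducedClass s →₀ ℕ) (i : Fin s) :
    totalSpec f i = f.sum fun U r => r * U.spec i := by
  rw [totalSpec, Finsupp.sum_apply]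
  rfl

theorem mul_spec_le {s : ℕ} (f : ReducedClass s →₀ ℕ) (U : ReducedClass s) (i : Fin s) :
    f U * U.spec i ≤ totalSpec f i := by
  rw [totalSpec_apply]
  by_cases h : U ∈ f.support
  · exact Finset.single_le_sum (f := fun U => f U * U.spec i) (fun _ _ => Nat.zero_le _) h
  · simp [Finsupp.notMem_support_iff.1 h]

/-- If one class already exhausts the total degree, no other class occurs. -/
theorem eq_single_of_mul_len_eq {s : ℕ} {f : ReducedClass s →₀ ℕ} {U : ReducedClass s}
    (h : f U * U.len = (totalSpec f).degree) : f = Finsupp.single U (f U) := by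
  classical
  ext V
  by_cases hV : V = U
  · rw [hV, Finsupp.single_eq_same]
  rw [Finsupp.single_eq_of_ne hV]
  by_contra hne
  have hVs : V ∈ f.support := Finsupp.mem_support_iff.2 hne
  have hle : ∑ W ∈ {U, V}, f W * W.len ≤ (totalSpec f).degree := by
    rw [degree_totalSpec, Finsupp.sum_of_support_subset f (s := insert U f.support)
      (Finset.subset_insert _ _) (fun W r => r * W.len) (by simp)]
    refine Finset.sum_le_sum_of_subset ?_
    intro W hW
    rcases Finset.mem_insert.1 hW with rfl | hW
    · exact Finset.mem_insert_self _ _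
    · rw [Finset.mem_singleton] at hW
      exact Finset.mem_insert_of_mem (hW ▸ hVs)
  rw [Finset.sum_pair (Ne.symm hV), h] at hle
  have := Nat.mul_pos (Nat.pos_of_ne_zero hne) V.len_pos
  omega

theorem subst_pair (w : Fin m →₀ ℕ) (b : ℕ) (u : Fin 2 →₀ ℕ) :
    subst ![w, b • w] u = (u 0 + b * u 1) • w := by
  simp [subst, Fin.sum_univ_two, add_smul, mul_smul, mul_comm b]

/-- Modulo the relations every `e_r(w^k)` is a polynomial in `e_1(w), …, e_n(w)`. For
`k < 1 + n / r` this is the relation `Q_{r,k}(w)`; for larger `k` put `i = ⌊n / r⌋` and use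
`S^{(r i, r)}(w, w^{k-i})`, in which `e_r(w^k)` comes from the class of `Y_1^i Y_2` taken `r` times,
while all other terms involve smaller indices or smaller powers. -/
theorem e_nsmul_mem_polyIn {w : Fin m →₀ ℕ} (hw : w ≠ 0) :
    ∀ r k, 1 ≤ r → 1 ≤ k → e K n r (k • w) ∈ polyIn K n w := by
  classical
  intro r
  induction r using Nat.strong_induction_on with
  | _ r ihr =>
  intro k
  induction k using Nat.strong_induction_on with
  | _ k ihk =>
  intro hr hk
  by_cases hrn : n < r
  · rw [e_of_lt hrn]
    exact zero_mem _
  by_cases hk1 : k = 1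
  · rw [hk1, one_smul]
    exact e_mem_polyIn w hr
  by_cases hkn : (k : ℚ) < 1 + (n : ℚ) / (r : ℚ)
  · refine mem_polyIn.2 ⟨MvPolynomial.map (Int.castRingHom K) (fpoly n r k), ?_⟩
    have hQ : Q K n r k w ∈ relIdeal K n m :=
      Ideal.subset_span (Or.inr ⟨r, k, w, hr, by omega, by omega, hkn, hw, rfl⟩)
    have hmap : MvPolynomial.aeval (R := K) (fun i : Fin n => e K n (i + 1) w)
        (MvPolynomial.map (Int.castRingHom K) (fpoly n r k)) =
        MvPolynomial.aeval (fun i : Fin n => e K n (i + 1) w) (fpoly n r k) :=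
      MvPolynomial.aeval_map_algebraMap K _ _
    rw [hmap]
    exact hQ
  set i := n / r with hi
  have hri : r * i ≤ n := Nat.mul_div_le n r
  have hri' : n < r * i + r := by
    have := Nat.lt_mul_div_succ n (show 0 < r by omega)
    rw [← hi] at this
    linarith
  have hik : i + 1 ≤ k := by
    by_contra hcon
    apply hkn
    have h1 : k ≤ i := by omega
    have h2 : (r : ℚ) * k ≤ n := by exact_mod_cast (Nat.mul_le_mul_left r h1).trans hri
    have h3 : (0 : ℚ) < r := by exact_mod_cast hr
    have h4 : (k : ℚ) ≤ n / r := by rw [le_div_iff₀ h3]; linarith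
    linarith
  obtain ⟨b, rfl⟩ := Nat.exists_eq_add_of_le (show i ≤ k by omega)
  have hb : 1 ≤ b := by omega
  obtain ⟨U₀, hU0, hU1⟩ := exists_class_count_one i
  set α : Fin 2 →₀ ℕ := r • U₀.spec with hα
  have hα0 : α 0 = r * i := by simp [hα, hU0]
  have hα1 : α 1 = r := by simp [hα, hU1]
  have hw' : ∀ j : Fin 2, (![w, b • w] : Fin 2 → (Fin m →₀ ℕ)) j ≠ 0 := by
    intro j
    fin_cases j
    · exact hw
    · exact nsmul_ne_zero hb hw
  have hS : amitsurS K n α ![w, b • w] ∈ relIdeal K n m := by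
    refine amitsurS_mem_relIdeal le_rfl hw' ?_ ?_
    · rw [Fin.sum_univ_two, hα0, hα1]; omega
    · intro j
      have hsum := Finset.add_sum_erase Finset.univ (fun i => α i) (Finset.mem_univ j)
      rw [Fin.sum_univ_two, hα0, hα1] at hsum
      fin_cases j
      · simp only [Fin.zero_eta, hα0] at hsum ⊢; omega
      · simp only [Fin.mk_one, hα1] at hsum ⊢; omega
  have hmem : Finsupp.single U₀ r ∈ classIndex α := by
    rw [mem_classIndex, totalSpec, Finsupp.sum_single_index (by simp)]
  have hS' := mem_polyIn_of_mem_relIdeal w hS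
  rw [amitsurS_eq_sum, ← Finset.add_sum_erase _ _ hmem, Finsupp.prod,
    Finsupp.support_single _ (by omega : r ≠ 0), Finset.prod_singleton,
    Finsupp.single_eq_same, subst_pair, hU0, hU1, mul_one] at hS'
  have hrest : ∑ f ∈ (classIndex α).erase (Finsupp.single U₀ r), (-1) ^ (α.degree + f.degree) *
      (f.prod fun U r => e K n r (subst ![w, b • w] U.spec)) ∈ polyIn K n w := by
    refine sum_mem fun f hf => mul_mem (pow_mem (neg_mem (one_mem _)) _) (prod_mem fun U hU => ?_)
    obtain ⟨hne, hf⟩ := Finset.mem_erase.1 hf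
    rw [mem_classIndex] at hf
    have hfU : 1 ≤ f U := Nat.pos_of_ne_zero (Finsupp.mem_support_iff.1 hU)
    have h0 := mul_spec_le f U 0
    have h1 := mul_spec_le f U 1
    rw [hf, hα0] at h0
    rw [hf, hα1] at h1
    beta_reduce
    rw [subst_pair]
    -- `Y_1` is the only reduced word without `Y_2`, and its factor is an `e_t(w)`
    by_cases hU1' : U.spec 1 = 0
    · rw [spec_of_count_one_eq_zero hU1', hU1', mul_zero, add_zero, one_smul]
      exact e_mem_polyIn w hfU
    have hU1'' : 1 ≤ U.spec 1 := Nat.pos_of_ne_zero hU1'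
    have hpos : 1 ≤ U.spec 0 + b * U.spec 1 := by nlinarith
    by_cases hlt : f U < r
    · exact ihr _ hlt _ hfU hpos
    have hfr : f U = r := by nlinarith
    have hs1 : U.spec 1 = 1 := by
      rw [hfr] at h1
      have : r * U.spec 1 ≤ r * 1 := by simpa using h1
      have := Nat.le_of_mul_le_mul_left this (by omega)
      omega
    rw [hfr] at h0
    have hs0 : U.spec 0 ≤ i := Nat.le_of_mul_le_mul_left h0 (by omega)
    rw [hfr, hs1, mul_one]
    -- now the factor is `e_r(w^{k'})` with `k' ≤ k`, and `k' = k` only in the removed term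
    refine ihk _ ?_ hr (by omega)
    by_contra hge
    apply hne
    have hs0' : U.spec 0 = i := by omega
    have hUU : U = U₀ := eq_of_count_one_eq_one hs1 hU1 (by rw [hs0', hU0])
    rw [← hUU, ← hfr]
    apply eq_single_of_mul_len_eq
    rw [hf, hα, hUU, ← hUU, hfr, map_nsmul, U.degree_spec, smul_eq_mul]
  have hE := sub_mem hS' hrest
  rw [add_sub_cancel_right] at hE
  have hsign := mul_mem (pow_mem (neg_mem (one_mem (polyIn K n w)))
    (α.degree + (Finsupp.single U₀ r).degree)) hE
  rwa [← mul_assoc, ← mul_pow, neg_one_mul, neg_neg, one_pow, one_mul] at hsign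

/-- When all the monomials coincide, `S^α(u, …, u)` is congruent to a multiple of `e_l(u)`,
`l = |α|`: both sides are polynomials in the `e_r(u^k)`, and their images agree. -/
theorem exists_amitsurS_const_sub_mem {u : Fin m →₀ ℕ} (hu : u ≠ 0) {s : ℕ} {α : Fin s →₀ ℕ}
    (hα : α ≠ 0) : ∃ c : ℕ, amitsurS K n α (fun _ => u) - c * e K n α.degree u ∈
      relIdeal K n m := by
  obtain ⟨c, hc⟩ := exists_phi_amitsurS_const (K := K) n hu α
  have hdeg : 1 ≤ α.degree := Nat.pos_of_ne_zero (by rwa [Ne, Finsupp.degree_eq_zero_iff])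
  refine ⟨c, mem_relIdeal_of_mem_polyIn hu (sub_mem ?_ ?_) ?_⟩
  · rw [amitsurS_eq_sum]
    refine sum_mem fun f _ => mul_mem (pow_mem (neg_mem (one_mem _)) _) (prod_mem fun U hU => ?_)
    have hsub : subst (fun _ => u) U.spec = U.len • u := by
      rw [subst, ← Finset.sum_smul, U.sum_spec]
    beta_reduce
    rw [hsub]
    exact e_nsmul_mem_polyIn hu _ _ (Nat.pos_of_ne_zero (Finsupp.mem_support_iff.1 hU)) U.len_pos
  · exact mul_mem (natCast_mem _ c) (e_mem_polyIn u hdeg)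
  · apply Subtype.ext
    rw [map_sub, map_mul, map_natCast, AddSubgroupClass.coe_sub, MulMemClass.coe_mul, hc,
      coe_phi_e hdeg hu]
    exact sub_self _

end Elimination

/-! ### Leading terms and a spanning set modulo the relations -/

section Leading

variable {s : ℕ}

theorem isReducedWord_singleton (i : Fin s) : IsReducedWord [i] := by
  refine ⟨by simp, fun V k hk h => ?_⟩
  have h1 := congrArg List.length h
  rw [← wordPow, length_wordPow, List.length_singleton] at h1
  have := Nat.eq_one_of_mul_eq_one_right h1.symm
  omega

/-- The class of the one-letter word `Y_i`. -/
def letter (i : Fin s) : ReducedClass s := ReducedClass.mk [i] (isReducedWord_singleton i)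

theorem spec_letter (i : Fin s) : (letter i).spec = Finsupp.single i 1 := by
  ext j
  rw [letter, ReducedClass.spec_mk, List.count_singleton, Finsupp.single_apply]
  simp

theorem letter_injective : Function.Injective (letter : Fin s → ReducedClass s) := by
  intro i j h
  have := congrArg ReducedClass.spec h
  rw [spec_letter, spec_letter] at this
  exact Finsupp.single_left_injective one_ne_zero this

theorem exists_eq_letter {U : ReducedClass s} (h : U.len = 1) : ∃ i, U = letter i := by
  obtain ⟨i, hi⟩ := List.length_eq_one_iff.1 h
  refine ⟨i, ?_⟩
  rw [letter, ← U.mk_rep, ReducedClass.mk_eq_iff, hi]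

/-- The multiset of classes `Y_1, …, Y_s` with multiplicities `α`. -/
noncomputable def letters (α : Fin s →₀ ℕ) : ReducedClass s →₀ ℕ :=
  α.embDomain ⟨letter, letter_injective⟩

theorem letters_letter (α : Fin s →₀ ℕ) (i : Fin s) : letters α (letter i) = α i :=
  Finsupp.embDomain_apply_self ⟨letter, letter_injective⟩ α i

theorem totalSpec_letters (α : Fin s →₀ ℕ) : totalSpec (letters α) = α := by
  rw [totalSpec, letters, Finsupp.sum_embDomain]
  simp [spec_letter]

theorem degree_letters (α : Fin s →₀ ℕ) : (letters α).degree = α.degree := by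
  rw [← totalSpec_letters α, degree_totalSpec, totalSpec_letters, Finsupp.degree_apply, Finsupp.sum]
  refine Finset.sum_congr rfl fun U hU => ?_
  rw [letters, Finsupp.support_embDomain, Finset.mem_map] at hU
  obtain ⟨i, _, rfl⟩ := hU
  rw [← ReducedClass.degree_spec]
  change _ = _ * (letter i).spec.degree
  rw [spec_letter, Finsupp.degree_single, mul_one]

/-- Among all terms of `S^α`, the product of the `e_{α_i}(w_i)` has the largest weight. -/
theorem degree_lt_of_ne_letters {α : Fin s →₀ ℕ} {f : ReducedClass s →₀ ℕ}
    (hf : totalSpec f = α) (hne : f ≠ letters α) : f.degree < α.degree := by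
  rw [← hf, degree_totalSpec, Finsupp.degree_apply, Finsupp.sum]
  have hle : ∀ U ∈ f.support, f U ≤ f U * U.len := fun U _ =>
    Nat.le_mul_of_pos_right _ U.len_pos
  by_contra hlt
  have hlen : ∀ U ∈ f.support, U.len = 1 := by
    intro U hU
    by_contra h1
    refine hlt (Finset.sum_lt_sum hle ⟨U, hU, ?_⟩)
    have h2 := U.len_pos
    have h3 := Nat.pos_of_ne_zero (Finsupp.mem_support_iff.1 hU)
    have h4 : 2 ≤ U.len := by omega
    nlinarith
  apply hne
  ext U
  by_cases hU : ∃ i, U = letter i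
  · obtain ⟨i, rfl⟩ := hU
    rw [letters_letter, ← hf, totalSpec_apply, Finsupp.sum, Finset.sum_eq_single (letter i)]
    · simp [spec_letter]
    · intro V hV hVi
      obtain ⟨j, rfl⟩ := exists_eq_letter (hlen V hV)
      have hji : j ≠ i := fun h => hVi (by rw [h])
      rw [spec_letter, Finsupp.single_apply, if_neg hji, mul_zero]
    · intro h
      rw [Finsupp.notMem_support_iff.1 h, zero_mul]
  · have h1 : f U = 0 := by
      by_contra h
      exact hU (exists_eq_letter (hlen U (Finsupp.mem_support_iff.2 h)))
    rw [h1, letters, Finsupp.embDomain_of_notMem_range]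
    rintro ⟨i, rfl⟩
    exact hU ⟨i, rfl⟩

theorem subst_single {m : ℕ} (w : Fin s → (Fin m →₀ ℕ)) (i : Fin s) :
    subst w (Finsupp.single i 1) = w i := by
  classical
  rw [subst, Finset.sum_eq_single i]
  · simp
  · intro j _ hj
    simp [hj]
  · simp

open Classical in
/-- The element `S^α(w)` is its leading term plus terms of smaller weight
(see `degree_lt_of_ne_letters`). -/
theorem amitsurS_eq_prod_add {K : Type*} [CommRing K] (n : ℕ) {m : ℕ} {α : Fin s →₀ ℕ}
    (hα : ∀ i, α i ≠ 0) (w : Fin s → (Fin m →₀ ℕ)) :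
    amitsurS K n α w = ∏ i, e K n (α i) (w i) + ∑ f ∈ (classIndex α).erase (letters α),
      (-1) ^ (α.degree + f.degree) * f.prod fun U r => e K n r (subst w U.spec) := by
  have hmem : letters α ∈ classIndex α := mem_classIndex.2 (totalSpec_letters α)
  have hsupp : α.support = Finset.univ := by
    ext i
    simpa using hα i
  rw [amitsurS_eq_sum, ← Finset.add_sum_erase _ _ hmem]
  congr 1
  rw [degree_letters, ← two_mul, pow_mul, neg_one_sq, one_pow, one_mul, letters,
    Finsupp.prod_embDomain, Finsupp.prod, hsupp]
  refine Finset.prod_congr rfl fun i _ => ?_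
  change e K n (α i) (subst w (letter i).spec) = _
  rw [spec_letter, subst_single]

end Leading

section Span

variable {K : Type*} [CommRing K] {n m : ℕ}

/-- The product of the elements `e_r(w)` over a multiset of pairs `(r, w)`. -/
noncomputable def eProd (K : Type*) [CommRing K] (n : ℕ) {m : ℕ}
    (M : Multiset (ℕ × (Fin m →₀ ℕ))) : ERing K n m :=
  (M.map fun p => e K n p.1 p.2).prod

/-- The weight of a product of elements `e_r(w)` is the sum of the indices `r`. -/
def weight {m : ℕ} (M : Multiset (ℕ × (Fin m →₀ ℕ))) : ℕ := (M.map Prod.fst).sum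

/-- All pairs `(r, w)` in the multiset satisfy `r ≥ 1` and `w ≠ 1`. -/
def IsProper {m : ℕ} (M : Multiset (ℕ × (Fin m →₀ ℕ))) : Prop := ∀ p ∈ M, 1 ≤ p.1 ∧ p.2 ≠ 0

theorem eProd_add (M M' : Multiset (ℕ × (Fin m →₀ ℕ))) :
    eProd K n (M + M') = eProd K n M * eProd K n M' := by simp [eProd]

theorem eProd_cons (p : ℕ × (Fin m →₀ ℕ)) (M : Multiset (ℕ × (Fin m →₀ ℕ))) :
    eProd K n (p ::ₘ M) = e K n p.1 p.2 * eProd K n M := by simp [eProd]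

theorem weight_add (M M' : Multiset (ℕ × (Fin m →₀ ℕ))) :
    weight (M + M') = weight M + weight M' := by simp [weight]

theorem weight_cons (p : ℕ × (Fin m →₀ ℕ)) (M : Multiset (ℕ × (Fin m →₀ ℕ))) :
    weight (p ::ₘ M) = p.1 + weight M := by simp [weight]

theorem IsProper.add {M M' : Multiset (ℕ × (Fin m →₀ ℕ))} (h : IsProper M) (h' : IsProper M') :
    IsProper (M + M') := fun p hp => (Multiset.mem_add.1 hp).elim (h p) (h' p)

theorem IsProper.mono {M M' : Multiset (ℕ × (Fin m →₀ ℕ))} (h : IsProper M) (hle : M' ≤ M) :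
    IsProper M' := fun p hp => h p (Multiset.mem_of_le hle hp)

/-- The multiplicity functions of multisets of at most `n` monomials different from `1`. -/
def stdIndex (n m : ℕ) : Set ((Fin m →₀ ℕ) →₀ ℕ) := {f | f.degree ≤ n ∧ f 0 = 0}

/-- The product of the `e_{f(u)}(u)` over the support of `f`. -/
noncomputable def stdProd (K : Type*) [CommRing K] (n : ℕ) {m : ℕ} (f : (Fin m →₀ ℕ) →₀ ℕ) :
    ERing K n m := f.prod fun u r => e K n r u

/-- The elements congruent, modulo the relations, to a linear combination of the products
`∏ e_{f(u)}(u)` of weight at most `n`. -/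
noncomputable def stdSpan (K : Type*) [CommRing K] (n m : ℕ) : Submodule K (ERing K n m) :=
  (relIdeal K n m).restrictScalars K ⊔ Submodule.span K (stdProd K n '' stdIndex n m)

theorem mem_stdSpan_of_mem_relIdeal {x : ERing K n m} (hx : x ∈ relIdeal K n m) :
    x ∈ stdSpan K n m :=
  (le_sup_left : (relIdeal K n m).restrictScalars K ≤ stdSpan K n m) hx

theorem exists_eq_map_univ {β : Type*} (M : Multiset β) {k : ℕ} (hk : M.card = k) :
    ∃ q : Fin k → β, Finset.univ.val.map q = M := by
  obtain ⟨l, rfl⟩ : ∃ l : List β, (l : Multiset β) = M := Quot.exists_rep M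
  obtain rfl : l.length = k := hk
  exact ⟨l.get, by rw [Fin.univ_val_map, List.ofFn_get]⟩

/-- A product of elements `e_r(u)` with distinct monomials `u` is one of the products
`∏ e_{f(u)}(u)`. -/
theorem exists_stdIndex_of_nodup (M : Multiset (ℕ × (Fin m →₀ ℕ))) (hM : IsProper M)
    (hd : (M.map Prod.snd).Nodup) : ∃ f : (Fin m →₀ ℕ) →₀ ℕ, stdProd K n f = eProd K n M ∧
      f.degree = weight M ∧ ∀ u, f u ≠ 0 → u ∈ M.map Prod.snd := by
  induction M using Multiset.induction_on with
  | empty => exact ⟨0, by simp [stdProd, eProd], by simp [weight], by simp⟩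
  | cons p M ih =>
    rw [Multiset.map_cons, Multiset.nodup_cons] at hd
    obtain ⟨f, h1, h2, h3⟩ := ih (hM.mono (Multiset.le_cons_self _ _)) hd.2
    have hp := hM p (Multiset.mem_cons_self _ _)
    have hp0 : p.1 ≠ 0 := by omega
    have hdisj : Disjoint (Finsupp.single p.2 p.1).support f.support := by
      rw [Finsupp.support_single _ hp0, Finset.disjoint_singleton_left]
      exact fun h => hd.1 (h3 _ (Finsupp.mem_support_iff.1 h))
    refine ⟨Finsupp.single p.2 p.1 + f, ?_, ?_, ?_⟩
    · rw [stdProd, Finsupp.prod_add_index_of_disjoint hdisj, eProd_cons, ← h1, stdProd]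
      congr 1
      rw [Finsupp.prod, Finsupp.support_single _ hp0, Finset.prod_singleton, Finsupp.single_eq_same]
    · rw [map_add, Finsupp.degree_single, h2, weight_cons]
    · intro u hu
      rw [Multiset.map_cons, Multiset.mem_cons]
      by_cases h : u = p.2
      · exact Or.inl h
      · refine Or.inr (h3 u ?_)
        rwa [Finsupp.add_apply, Finsupp.single_eq_of_ne h, zero_add] at hu

/-- Rewriting with `S^α(w)` replaces a product of weight `|α|` by products of smaller weight. -/
theorem prod_sub_amitsurS_mem {s : ℕ} {α : Fin s →₀ ℕ} (hα : ∀ i, α i ≠ 0)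
    {w : Fin s → (Fin m →₀ ℕ)} (hw : ∀ i, w i ≠ 0) {M : Multiset (ℕ × (Fin m →₀ ℕ))}
    (hM : IsProper M) (ih : ∀ M' : Multiset (ℕ × (Fin m →₀ ℕ)), IsProper M' →
      weight M' < α.degree + weight M → eProd K n M' ∈ stdSpan K n m) :
    (∏ i, e K n (α i) (w i)) * eProd K n M - amitsurS K n α w * eProd K n M ∈ stdSpan K n m := by
  classical
  rw [amitsurS_eq_prod_add n hα, add_mul, sub_add_cancel_left, Finset.sum_mul]
  refine neg_mem (sum_mem fun f hf => ?_)
  obtain ⟨hne, hf⟩ := Finset.mem_erase.1 hf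
  have hlt := degree_lt_of_ne_letters (mem_classIndex.1 hf) hne
  set M' : Multiset (ℕ × (Fin m →₀ ℕ)) := f.support.val.map fun U => (f U, subst w U.spec) with hM'
  have h1 : (f.prod fun U r => e K n r (subst w U.spec)) = eProd K n M' := by
    rw [hM', eProd, Multiset.map_map]
    rfl
  have h2 : weight M' = f.degree := by
    rw [hM', weight, Multiset.map_map]
    rfl
  have h3 : IsProper M' := by
    intro p hp
    obtain ⟨U, hU, rfl⟩ := Multiset.mem_map.1 hp
    exact ⟨Nat.pos_of_ne_zero (Finsupp.mem_support_iff.1 hU), subst_ne_zero hw U.spec_ne_zero⟩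
  rw [h1, mul_assoc, ← eProd_add]
  have h4 := ih (M' + M) (h3.add hM) (by rw [weight_add, h2]; omega)
  rcases neg_one_pow_eq_or (ERing K n m) (α.degree + f.degree) with h | h
  · rwa [h, one_mul]
  · rw [h, neg_one_mul]
    exact neg_mem h4

/-- A multiset of pairs of weight greater than `n` with all `r ≤ n` contains the leading term of
one of the elements `S^α(w)` in the ideal, namely a minimal submultiset of weight greater
than `n`. -/
theorem exists_leading_le {M : Multiset (ℕ × (Fin m →₀ ℕ))} (hM : IsProper M)
    (hle : ∀ p ∈ M, p.1 ≤ n) (hlt : n < weight M) :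
    ∃ (s : ℕ) (α : Fin s →₀ ℕ) (w : Fin s → (Fin m →₀ ℕ)) (M' : Multiset (ℕ × (Fin m →₀ ℕ))),
      (∀ i, α i ≠ 0) ∧ (∀ i, w i ≠ 0) ∧ amitsurS K n α w ∈ relIdeal K n m ∧ M' ≤ M ∧
      eProd K n M = (∏ i, e K n (α i) (w i)) * eProd K n M' ∧
      weight M = α.degree + weight M' := by
  classical
  obtain ⟨M₁, hM₁, hmin⟩ := exists_minimal_le_of_wellFoundedLT (fun M₁ => M₁ ≤ M ∧ n < weight M₁) M
    ⟨le_rfl, hlt⟩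
  obtain ⟨⟨-, hlt₁⟩, hmin⟩ := hmin
  obtain ⟨q, hq⟩ := exists_eq_map_univ M₁ rfl
  have hmem : ∀ i, q i ∈ M₁ := fun i => by
    rw [← hq]
    exact Multiset.mem_map_of_mem _ (Finset.mem_univ i)
  obtain ⟨M', rfl⟩ := Multiset.le_iff_exists_add.1 hM₁
  have hprop : ∀ i, 1 ≤ (q i).1 ∧ (q i).2 ≠ 0 := fun i => hM _ (Multiset.mem_of_le hM₁ (hmem i))
  set α : Fin M₁.card →₀ ℕ := Finsupp.equivFunOnFinite.symm fun i => (q i).1 with hα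
  have hsum : ∑ i, α i = weight M₁ := by
    conv_rhs => rw [← hq, weight, Multiset.map_map]
    rfl
  have herase : ∀ j, ∑ i ∈ Finset.univ.erase j, α i ≤ n := by
    intro j
    by_contra hcon
    have h1 : (q j).1 + weight (M₁.erase (q j)) = weight M₁ := by
      rw [← weight_cons, Multiset.cons_erase (hmem j)]
    have h2 := Finset.add_sum_erase Finset.univ (fun i => α i) (Finset.mem_univ j)
    rw [hsum, ← h1] at h2
    have h3 : α j = (q j).1 := rfl
    have h4 : n < weight (M₁.erase (q j)) := by
      omega
    have h5 := hmin ⟨(Multiset.erase_le _ _).trans hM₁, h4⟩ (Multiset.erase_le _ _)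
    have h6 := Multiset.card_le_card h5
    rw [Multiset.card_erase_of_mem (hmem j)] at h6
    have h7 := Multiset.card_pos_iff_exists_mem.2 ⟨_, hmem j⟩
    rw [Nat.pred_eq_sub_one] at h6
    omega
  have hcard : 2 ≤ M₁.card := by
    by_contra hcon
    have h01 : M₁.card = 0 ∨ M₁.card = 1 := by omega
    rcases h01 with h0 | h1
    · rw [Multiset.card_eq_zero.1 h0] at hlt₁
      simp [weight] at hlt₁
    · obtain ⟨p, hp⟩ := Multiset.card_eq_one.1 h1
      rw [hp] at hlt₁
      have := hle p (Multiset.mem_of_le hM₁ (by rw [hp]; exact Multiset.mem_singleton_self p))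
      simp [weight] at hlt₁
      omega
  refine ⟨M₁.card, α, fun i => (q i).2, M', fun i => ?_, fun i => (hprop i).2,
    amitsurS_mem_relIdeal hcard (fun i => (hprop i).2) (by rw [hsum]; exact hlt₁) herase,
    Multiset.le_add_left _ _, ?_, ?_⟩
  · have := (hprop i).1
    change (q i).1 ≠ 0
    omega
  · rw [eProd_add]
    congr 1
    conv_lhs => rw [← hq, eProd, Multiset.map_map]
    rfl
  · rw [weight_add, Finsupp.degree_eq_sum, hsum]

theorem exists_eq_cons_cons {M : Multiset (ℕ × (Fin m →₀ ℕ))} (h : ¬ (M.map Prod.snd).Nodup) :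
    ∃ r r' u M', M = (r, u) ::ₘ (r', u) ::ₘ M' := by
  classical
  rw [Multiset.nodup_iff_ne_cons_cons] at h
  push Not at h
  obtain ⟨u, t, ht⟩ := h
  obtain ⟨p, hp, hpu, hpt⟩ := (Multiset.map_eq_cons _ _ _ _).2 ht
  obtain ⟨p', hp', hpu', -⟩ := (Multiset.map_eq_cons _ _ _ _).2 hpt
  refine ⟨p.1, p'.1, u, (M.erase p).erase p', ?_⟩
  rw [← hpu]
  conv_rhs => rw [hpu, ← hpu']
  rw [Multiset.cons_erase hp', hpu', ← hpu, Multiset.cons_erase hp]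

/-- Modulo the relations every product of elements `e_r(w)` is a linear combination of the
products `∏ e_{f(u)}(u)` with distinct monomials `u` and of weight at most `n`: weights greater
than `n` are lowered by the `S^α(w)`, and two factors `e_r(u) e_{r'}(u)` are merged into a multiple
of `e_{r+r'}(u)` up to terms of lower weight. -/
theorem eProd_mem_stdSpan : ∀ (W c : ℕ) (M : Multiset (ℕ × (Fin m →₀ ℕ))), IsProper M →
    weight M = W → M.card = c → eProd K n M ∈ stdSpan K n m := by
  intro W
  induction W using Nat.strong_induction_on with
  | _ W ihW =>
  intro c
  induction c using Nat.strong_induction_on with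
  | _ c ihc =>
  intro M hM hW hc
  by_cases hle : ∀ p ∈ M, p.1 ≤ n
  swap
  · push Not at hle
    obtain ⟨p, hp, hpn⟩ := hle
    have h0 : eProd K n M = 0 := by
      rw [eProd]
      exact Multiset.prod_eq_zero (Multiset.mem_map.2 ⟨p, hp, e_of_lt hpn _⟩)
    rw [h0]
    exact zero_mem _
  by_cases hlt : n < weight M
  · obtain ⟨s, α, w, M', hα, hw, hS, hM', hE, hwt⟩ := exists_leading_le (K := K) hM hle hlt
    have h1 := prod_sub_amitsurS_mem (K := K) hα hw (hM.mono hM') fun M'' hM'' hlt' =>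
      ihW _ (by omega) _ M'' hM'' rfl rfl
    rw [hE]
    have h2 := add_mem h1 (mem_stdSpan_of_mem_relIdeal (Ideal.mul_mem_right (eProd K n M') _ hS))
    rwa [sub_add_cancel] at h2
  by_cases hd : (M.map Prod.snd).Nodup
  · obtain ⟨f, h1, h2, h3⟩ := exists_stdIndex_of_nodup (K := K) (n := n) M hM hd
    rw [← h1]
    refine (le_sup_right : _ ≤ stdSpan K n m) (Submodule.subset_span ⟨f, ⟨by omega, ?_⟩, rfl⟩)
    by_contra h0
    obtain ⟨p, hp, hp0⟩ := Multiset.mem_map.1 (h3 0 h0)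
    exact (hM p hp).2 hp0
  · obtain ⟨r, r', u, M', rfl⟩ := exists_eq_cons_cons hd
    have hp := hM (r, u) (Multiset.mem_cons_self _ _)
    have hp' := hM (r', u) (Multiset.mem_cons_of_mem (Multiset.mem_cons_self _ _))
    have hM' : IsProper M' := hM.mono ((Multiset.le_cons_self _ _).trans (Multiset.le_cons_self _ _))
    simp only at hp hp'
    set α : Fin 2 →₀ ℕ := Finsupp.equivFunOnFinite.symm ![r, r'] with hα
    have hα0 : ∀ i, α i ≠ 0 := by
      intro i
      fin_cases i
      · change r ≠ 0; omega
      · change r' ≠ 0; omega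
    have hdeg : α.degree = r + r' := by
      rw [Finsupp.degree_eq_sum, Fin.sum_univ_two]
      rfl
    rw [weight_cons, weight_cons] at hW
    simp only at hW
    rw [Multiset.card_cons, Multiset.card_cons] at hc
    obtain ⟨k, hk⟩ := exists_amitsurS_const_sub_mem (K := K) (n := n) hp.2
      (α := α) (fun h => hα0 0 (by rw [h]; rfl))
    have h1 := prod_sub_amitsurS_mem (K := K) hα0 (fun _ => hp.2) hM' fun M'' hM'' hlt' =>
      ihW _ (by omega) _ M'' hM'' rfl rfl
    have h2 : eProd K n ((r + r', u) ::ₘ M') ∈ stdSpan K n m := by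
      refine ihc (M'.card + 1) (by omega) _ ?_ ?_ (Multiset.card_cons _ _)
      · intro p hpm
        rcases Multiset.mem_cons.1 hpm with rfl | h
        · exact ⟨by change 1 ≤ r + r'; omega, hp.2⟩
        · exact hM' p h
      · rw [weight_cons]
        change r + r' + _ = _
        omega
    have h3 := mem_stdSpan_of_mem_relIdeal (Ideal.mul_mem_right (eProd K n M') _ hk)
    have h4 := add_mem (add_mem h1 h3) (nsmul_mem h2 k)
    have hE : eProd K n ((r, u) ::ₘ (r', u) ::ₘ M') =
        (∏ i, e K n (α i) u) * eProd K n M' - amitsurS K n α (fun _ => u) * eProd K n M' +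
        (amitsurS K n α (fun _ => u) - k * e K n α.degree u) * eProd K n M' +
        k • eProd K n ((r + r', u) ::ₘ M') := by
      have h5 : ∏ i, e K n (α i) u = e K n r u * e K n r' u := by
        rw [Fin.prod_univ_two]
        rfl
      rw [eProd_cons, eProd_cons, eProd_cons, h5, hdeg, nsmul_eq_mul]
      ring
    rw [hE]
    exact h4

theorem stdSpan_eq_top : stdSpan K n m = ⊤ := by
  have h1 : ∀ x ∈ Submonoid.closure (Set.range (MvPolynomial.X : EVar n m → ERing K n m)),
      ∃ M : Multiset (ℕ × (Fin m →₀ ℕ)), IsProper M ∧ eProd K n M = x := by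
    intro x hx
    induction hx using Submonoid.closure_induction with
    | mem x hx =>
      obtain ⟨v, rfl⟩ := hx
      refine ⟨{v.1}, ?_, ?_⟩
      · intro p hp
        rw [Multiset.mem_singleton.1 hp]
        exact ⟨v.2.1.1, v.2.2⟩
      · rw [eProd, Multiset.map_singleton, Multiset.prod_singleton, e, dif_pos v.2]
    | one => exact ⟨0, by simp [IsProper], by simp [eProd]⟩
    | mul x y _ _ hx hy =>
      obtain ⟨M, hM, rfl⟩ := hx
      obtain ⟨M', hM', rfl⟩ := hy
      exact ⟨M + M', hM.add hM', eProd_add M M'⟩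
  have h2 := Algebra.adjoin_eq_span K (Set.range (MvPolynomial.X : EVar n m → ERing K n m))
  rw [MvPolynomial.adjoin_range_X, Algebra.top_toSubmodule] at h2
  rw [eq_top_iff, h2, Submodule.span_le]
  intro x hx
  obtain ⟨M, hM, rfl⟩ := h1 x hx
  exact eProd_mem_stdSpan _ _ M hM rfl rfl

end Span

/-! ### Linear independence -/

section Independence

variable {K : Type*} [CommRing K] {n m : ℕ}

/-- The exponent vector of `u_⟨j⟩`. -/
noncomputable def placeExp {n m : ℕ} (u : Fin m →₀ ℕ) (j : Fin n) : Fin m × Fin n →₀ ℕ :=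
  ∑ i, Finsupp.single (i, j) (u i)

theorem placeExp_apply (u : Fin m →₀ ℕ) (j j' : Fin n) (i : Fin m) :
    placeExp u j (i, j') = if j = j' then u i else 0 := by
  classical
  rw [placeExp, Finsupp.finsetSum_apply, Finset.sum_eq_single i]
  · by_cases h : j = j'
    · rw [h, Finsupp.single_eq_same, if_pos rfl]
    · rw [if_neg h, Finsupp.single_apply, if_neg (by simp [h])]
  · intro i' _ hi'
    rw [Finsupp.single_apply, if_neg (by simp [hi'])]
  · simp

theorem place_eq_monomial (u : Fin m →₀ ℕ) (j : Fin n) :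
    place K u j = MvPolynomial.monomial (placeExp u j) 1 := by
  have h := prod_monomial (R := K) Finset.univ (fun i => Finsupp.single (i, j) (u i)) fun _ => 1
  rw [Finset.prod_const_one] at h
  rw [placeExp, ← h, place]
  exact Finset.prod_congr rfl fun i _ => MvPolynomial.X_pow_eq_monomial

/-- The exponent vector occurring in `∏_u σ_{g(u)}(u)` for the choice of index sets `I_u`. -/
noncomputable def choiceExp {n m : ℕ} {S : Finset (Fin m →₀ ℕ)} (I : S → Finset (Fin n)) :
    Fin m × Fin n →₀ ℕ :=
  ∑ u : S, ∑ j ∈ I u, placeExp u.1 j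

theorem choiceExp_apply {S : Finset (Fin m →₀ ℕ)} (I : S → Finset (Fin n)) (i : Fin m) (j : Fin n) :
    choiceExp I (i, j) = ∑ u : S with j ∈ I u, u.1 i := by
  classical
  rw [choiceExp, Finsupp.finsetSum_apply, Finset.sum_filter]
  refine Finset.sum_congr rfl fun u _ => ?_
  rw [Finsupp.finsetSum_apply]
  simp [placeExp_apply]

theorem coe_phi_stdProd {g : (Fin m →₀ ℕ) →₀ ℕ} (hg : g 0 = 0) :
    (phi K n m (stdProd K n g) : MvPolynomial (Fin m × Fin n) K) =
      ∑ I ∈ Fintype.piFinset fun u : g.support =>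
        (Finset.univ : Finset (Fin n)).powersetCard (g u.1),
        MvPolynomial.monomial (choiceExp I) 1 := by
  classical
  have h1 : (phi K n m (stdProd K n g) : MvPolynomial (Fin m × Fin n) K) =
      ∏ u : g.support, sigma K n (g u.1) u.1 := by
    rw [stdProd, Finsupp.prod, map_prod, ← Finset.prod_coe_sort]
    push_cast
    refine Finset.prod_congr rfl fun u _ => coe_phi_e ?_ ?_
    · exact Nat.pos_of_ne_zero (Finsupp.mem_support_iff.1 u.2)
    · intro h
      have := Finsupp.mem_support_iff.1 u.2
      rw [h] at this
      exact this hg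
  rw [h1]
  simp only [sigma, place_eq_monomial, prod_monomial, Finset.prod_const_one]
  rw [Finset.prod_univ_sum]
  refine Finset.sum_congr rfl fun I _ => ?_
  rw [prod_monomial, Finset.prod_const_one, choiceExp]

/-- An assignment of monomials to the `n` places in which every `u ≠ 1` occurs `f(u)` times. -/
def IsArrangement (f : (Fin m →₀ ℕ) →₀ ℕ) (q : Fin n → (Fin m →₀ ℕ)) : Prop :=
  ∀ u, u ≠ 0 → (Finset.univ.filter fun j => q j = u).card = f u

theorem exists_arrangement {f : (Fin m →₀ ℕ) →₀ ℕ} (hf : f ∈ stdIndex n m) :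
    ∃ q : Fin n → (Fin m →₀ ℕ), IsArrangement f q := by
  classical
  have hcard : (Finsupp.toMultiset f + Multiset.replicate (n - f.degree) 0).card = n := by
    rw [Multiset.card_add, Multiset.card_replicate, Finsupp.card_toMultiset]
    have h1 : (f.sum fun _ => id) = f.degree := rfl
    have h2 : f.degree ≤ n := hf.1
    rw [h1]
    omega
  obtain ⟨q, hq⟩ := exists_eq_map_univ _ hcard
  refine ⟨q, fun u hu => ?_⟩
  have h := congrArg (Multiset.count u) hq
  rw [Multiset.count_map, Multiset.count_add, Finsupp.count_toMultiset, Multiset.count_replicate,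
    if_neg (Ne.symm hu), add_zero] at h
  rw [← h, Finset.card_def, Finset.filter_val]
  congr 1
  refine Multiset.filter_congr fun j _ => eq_comm

/-- The total number of places carrying a monomial different from `1` is the degree of `f`. -/
theorem card_ne_zero_of_arrangement {f : (Fin m →₀ ℕ) →₀ ℕ} (hf0 : f 0 = 0)
    {q : Fin n → (Fin m →₀ ℕ)} (hq : IsArrangement f q) :
    (Finset.univ.filter fun j => q j ≠ 0).card = f.degree := by
  classical
  have hmaps : ∀ j ∈ Finset.univ.filter (fun j => q j ≠ 0), q j ∈ f.support := by
    intro j hj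
    have hj' := (Finset.mem_filter.1 hj).2
    rw [Finsupp.mem_support_iff, ← hq _ hj']
    exact (Finset.card_pos.2 ⟨j, by simp⟩).ne'
  rw [Finset.card_eq_sum_card_fiberwise hmaps, Finsupp.degree_apply]
  refine Finset.sum_congr rfl fun u hu => ?_
  have hu0 : u ≠ 0 := by
    rintro rfl
    exact (Finsupp.mem_support_iff.1 hu) hf0
  rw [← hq u hu0, Finset.filter_filter]
  congr 1
  ext j
  simp only [Finset.mem_filter, Finset.mem_univ, true_and]
  exact ⟨fun h => h.2, fun h => ⟨h ▸ hu0, h⟩⟩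

/-- If `g` has at most the degree of `f`, then the monomial `∏_j q(j)_⟨j⟩` of an arrangement `q` of
`f` arises in `∏_u σ_{g(u)}(u)` only from the index sets `I_u = {j | q(j) = u}`: the number of
non-trivial places forces these sets to be disjoint. -/
theorem mem_iff_of_choiceExp_eq {f g : (Fin m →₀ ℕ) →₀ ℕ} (hf0 : f 0 = 0)
    {q : Fin n → (Fin m →₀ ℕ)} (hq : IsArrangement f q) (hdeg : g.degree ≤ f.degree)
    {I : g.support → Finset (Fin n)} (hI : ∀ u, (I u).card = g u.1)
    (hE : ∀ i j, choiceExp I (i, j) = q j i) :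
    (∀ u j, j ∈ I u ↔ q j = u.1) ∧ ∀ j, q j ≠ 0 → q j ∈ g.support := by
  classical
  set N : Fin n → ℕ := fun j => (Finset.univ.filter fun u : g.support => j ∈ I u).card with hN
  have hqsum : ∀ j, q j = ∑ u : g.support with j ∈ I u, u.1 := by
    intro j
    ext i
    rw [← hE i j, choiceExp_apply, Finsupp.finsetSum_apply]
  have hsumN : ∑ j, N j = g.degree := by
    have h1 : ∑ j, N j = ∑ u : g.support, (I u).card := by
      simp only [hN, Finset.card_filter]
      rw [Finset.sum_comm]
      exact Finset.sum_congr rfl fun u _ => by simp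
    rw [h1, Finset.sum_congr rfl fun u _ => hI u, Finsupp.degree_apply,
      Finset.sum_coe_sort g.support fun u => g u]
  have hge : ∀ j ∈ Finset.univ, (if q j ≠ 0 then 1 else 0) ≤ N j := by
    intro j _
    split_ifs with h
    · by_contra hlt
      have h0 : N j = 0 := by omega
      apply h
      rw [hqsum j, Finset.card_eq_zero.1 h0, Finset.sum_empty]
    · exact Nat.zero_le _
  have hsumq : ∑ j, (if q j ≠ 0 then 1 else 0) = f.degree := by
    rw [← card_ne_zero_of_arrangement hf0 hq, Finset.card_filter]
  have hNq : ∀ j, (if q j ≠ 0 then 1 else 0) = N j := by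
    intro j
    have hle := Finset.sum_le_sum hge
    exact (Finset.sum_eq_sum_iff_of_le hge).1 (by omega) j (Finset.mem_univ j)
  have hval : ∀ u j, j ∈ I u → q j = u.1 := by
    intro u j hj
    have hmem : u ∈ Finset.univ.filter fun u : g.support => j ∈ I u := by simpa using hj
    have h1 : N j = 1 := by
      have h2 : 0 < N j := Finset.card_pos.2 ⟨u, hmem⟩
      have h3 := hNq j
      split_ifs at h3 <;> omega
    obtain ⟨v, hv⟩ := Finset.card_eq_one.1 h1
    rw [hqsum j, hv, Finset.sum_singleton]
    rw [hv, Finset.mem_singleton] at hmem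
    rw [hmem]
  have hex : ∀ j, q j ≠ 0 → ∃ u, j ∈ I u ∧ q j = u.1 := by
    intro j hj
    have h1 := hNq j
    rw [if_pos hj] at h1
    obtain ⟨v, hv⟩ := Finset.card_eq_one.1 h1.symm
    have hmem : v ∈ Finset.univ.filter fun u : g.support => j ∈ I u := by
      rw [hv]; exact Finset.mem_singleton_self v
    have hj' : j ∈ I v := by simpa using hmem
    exact ⟨v, hj', hval v j hj'⟩
  refine ⟨fun u j => ⟨hval u j, fun h => ?_⟩, fun j hj => ?_⟩
  · by_cases h0 : q j = 0
    · -- here `u = 1`; all places in the sets `I_u` carry monomials different from `1`, so this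
      -- `I_u` is empty, against `g(u) > 0`
      have hu : 0 < g u.1 := Nat.pos_of_ne_zero (Finsupp.mem_support_iff.1 u.2)
      rw [← hI u] at hu
      obtain ⟨k, hk⟩ := Finset.card_pos.1 hu
      have h1 : N k ≠ 0 := (Finset.card_pos.2 ⟨u, by simpa using hk⟩).ne'
      have h2 := hNq k
      rw [if_neg (by rw [hval u k hk, ← h, h0]; simp)] at h2
      exact absurd h2.symm h1
    · obtain ⟨v, hv, hqv⟩ := hex j h0
      have : u = v := Subtype.ext (by rw [← h, hqv])
      rwa [this]
  · obtain ⟨v, _, hqv⟩ := hex j hj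
    rw [hqv]
    exact v.2

/-- The exponent vector of the monomial `∏_j q(j)_⟨j⟩`. -/
noncomputable def arrangementExp {n m : ℕ} (q : Fin n → (Fin m →₀ ℕ)) : Fin m × Fin n →₀ ℕ :=
  Finsupp.equivFunOnFinite.symm fun p => q p.2 p.1

theorem choiceExp_eq_iff {S : Finset (Fin m →₀ ℕ)} (I : S → Finset (Fin n))
    (q : Fin n → (Fin m →₀ ℕ)) :
    choiceExp I = arrangementExp q ↔ ∀ i j, choiceExp I (i, j) = q j i := by
  rw [Finsupp.ext_iff]
  exact ⟨fun h i j => h (i, j), fun h p => h p.1 p.2⟩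

/-- Unitriangularity: among the products `∏ σ_{g(u)}(u)` with `|g| ≤ |f|`, only the one with `g = f`
contains the monomial of an arrangement of `f`, with coefficient `1`. -/
theorem coeff_phi_stdProd (f : (Fin m →₀ ℕ) →₀ ℕ) {g : (Fin m →₀ ℕ) →₀ ℕ} (hf0 : f 0 = 0)
    (hg0 : g 0 = 0) {q : Fin n → (Fin m →₀ ℕ)} (hq : IsArrangement f q)
    (hdeg : g.degree ≤ f.degree) :
    MvPolynomial.coeff (arrangementExp q)
      (phi K n m (stdProd K n g) : MvPolynomial (Fin m × Fin n) K) = if g = f then 1 else 0 := by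
  classical
  have hsupp0 : ∀ u ∈ g.support, u ≠ 0 := by
    rintro u hu rfl
    exact (Finsupp.mem_support_iff.1 hu) hg0
  rw [coe_phi_stdProd hg0, MvPolynomial.coeff_sum]
  simp only [MvPolynomial.coeff_monomial]
  split_ifs with hgf
  · subst hgf
    set I₀ : g.support → Finset (Fin n) := fun u => Finset.univ.filter fun j => q j = u.1 with hI₀
    have hmem : I₀ ∈ Fintype.piFinset fun u : g.support =>
        (Finset.univ : Finset (Fin n)).powersetCard (g u.1) := by
      rw [Fintype.mem_piFinset]
      intro u
      rw [Finset.mem_powersetCard]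
      exact ⟨Finset.subset_univ _, hq _ (hsupp0 _ u.2)⟩
    rw [Finset.sum_eq_single_of_mem I₀ hmem, if_pos]
    · rw [choiceExp_eq_iff]
      intro i j
      rw [choiceExp_apply]
      by_cases hj : q j = 0
      · rw [hj, Finset.filter_eq_empty_iff.2, Finset.sum_empty]
        · rfl
        · intro u _ h
          rw [hI₀, Finset.mem_filter] at h
          exact hsupp0 _ u.2 (h.2 ▸ hj)
      · have hjs : q j ∈ g.support := by
          rw [Finsupp.mem_support_iff, ← hq _ hj]
          exact (Finset.card_pos.2 ⟨j, by simp⟩).ne'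
        have hfil : (Finset.univ.filter fun u : g.support => j ∈ I₀ u) = {⟨q j, hjs⟩} := by
          ext u
          simp [hI₀, Subtype.ext_iff, eq_comm]
        rw [hfil, Finset.sum_singleton]
    · intro I hI hne
      rw [if_neg]
      intro hE
      apply hne
      rw [Fintype.mem_piFinset] at hI
      have h := (mem_iff_of_choiceExp_eq hf0 hq hdeg
        (fun u => (Finset.mem_powersetCard.1 (hI u)).2) ((choiceExp_eq_iff _ _).1 hE)).1
      funext u
      ext j
      rw [h u j]
      simp [hI₀]
  · refine Finset.sum_eq_zero fun I hI => if_neg fun hE => hgf ?_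
    rw [Fintype.mem_piFinset] at hI
    have hcard : ∀ u, (I u).card = g u.1 := fun u => (Finset.mem_powersetCard.1 (hI u)).2
    obtain ⟨h1, h2⟩ := mem_iff_of_choiceExp_eq hf0 hq hdeg hcard ((choiceExp_eq_iff _ _).1 hE)
    ext u
    by_cases hu : u ∈ g.support
    · rw [← hcard ⟨u, hu⟩, ← hq u (hsupp0 u hu)]
      congr 1
      ext j
      rw [h1 ⟨u, hu⟩ j]
      simp
    · rw [Finsupp.notMem_support_iff.1 hu]
      by_cases hu0 : u = 0
      · rw [hu0, hf0]
      · rw [← hq u hu0, eq_comm, Finset.card_eq_zero, Finset.filter_eq_empty_iff]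
        rintro j _ rfl
        exact hu (h2 j hu0)

/-- The images under `φ` of the products `∏ e_{f(u)}(u)` of weight at most `n` are linearly
independent. -/
theorem eq_zero_of_phi_linearCombination {c : ((Fin m →₀ ℕ) →₀ ℕ) →₀ K}
    (hc : ∀ f ∈ c.support, f ∈ stdIndex n m)
    (h : phi K n m (Finsupp.linearCombination K (stdProd K n) c) = 0) : c = 0 := by
  by_contra hne
  obtain ⟨f, hf, hmax⟩ := Finset.exists_max_image c.support (fun f => f.degree)
    (Finsupp.support_nonempty_iff.2 hne)
  obtain ⟨q, hq⟩ := exists_arrangement (hc f hf)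
  have h1 := congrArg (fun x : multisymmetric K n m => MvPolynomial.coeff (arrangementExp q)
    (x : MvPolynomial (Fin m × Fin n) K)) h
  simp only [Finsupp.linearCombination_apply, Finsupp.sum, map_sum, map_smul] at h1
  rw [AddSubmonoidClass.coe_finsetSum, MvPolynomial.coeff_sum,
    Finset.sum_eq_single_of_mem f hf] at h1
  · rw [Subalgebra.coe_smul, MvPolynomial.coeff_smul,
      coeff_phi_stdProd f (hc f hf).2 (hc f hf).2 hq le_rfl, if_pos rfl] at h1
    exact (Finsupp.mem_support_iff.1 hf) (by simpa using h1)
  · intro g hg hgf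
    rw [Subalgebra.coe_smul, MvPolynomial.coeff_smul,
      coeff_phi_stdProd f (hc f hf).2 (hc g hg).2 hq (hmax g hg), if_neg hgf, smul_zero]

theorem ker_phi_eq_relIdeal : RingHom.ker (phi K n m) = relIdeal K n m := by
  refine le_antisymm (fun x hx => ?_) relIdeal_le_ker
  have htop : x ∈ stdSpan K n m := by rw [stdSpan_eq_top]; exact Submodule.mem_top
  obtain ⟨y, hy, z, hz, rfl⟩ := Submodule.mem_sup.1 htop
  obtain ⟨c, hc, rfl⟩ := (Finsupp.mem_span_image_iff_linearCombination K).1 hz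
  have hy' : y ∈ relIdeal K n m := hy
  rw [RingHom.mem_ker, map_add, RingHom.mem_ker.1 (relIdeal_le_ker hy'), zero_add] at hx
  rw [eq_zero_of_phi_linearCombination (fun f hf => hc hf) hx, map_zero, add_zero]
  exact hy'

end Independence

end Multisymmetric

theorem mainTheorem4 (K : Type*) [CommRing K] (n m : ℕ) :
    RingHom.ker (Multisymmetric.phi K n m) =
      Ideal.span
        ({S | ∃ (s : ℕ) (α : Fin s →₀ ℕ) (w : Fin s → (Fin m →₀ ℕ)),
            2 ≤ s ∧ (∀ i, w i ≠ 0) ∧ n < ∑ i, α i ∧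
            (∀ j, ∑ i ∈ Finset.univ.erase j, α i ≤ n) ∧
            S = Multisymmetric.amitsurS K n α w} ∪
          {q | ∃ (r k : ℕ) (w : Fin m →₀ ℕ),
            1 ≤ r ∧ r ≤ n ∧ 2 ≤ k ∧ (k : ℚ) < 1 + (n : ℚ) / (r : ℚ) ∧ w ≠ 0 ∧
            q = Multisymmetric.Q K n r k w}) :=
  Multisymmetric.ker_phi_eq_relIdeal
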